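/- Setting. Let $\Theta\subset\mathbb R^{d}$ be compact and let $\{P_\theta:\theta\in\Theta\}$ be a parametric model for a process $(y_t)_{t\ge1}$ such that, under $P_\theta$, $y_t$ has conditional density $p(y_t\mid y_{t-1},\dots,y_1;\theta)$ with respect to a $\sigma$-finite measure. The data $y_1,\dots,y_T$ are generated by $P_{\theta^0}$ with $\theta^0\in\mathrm{Int}(\Theta)$; for each $\theta\in\Theta$ there is a simulated path $\tilde y_1(\theta),\dots,\tilde y_T(\theta)$ with law $P_\theta$. For $\beta\in\mathbf B=\Theta$ let $$Q_T(\beta)=\frac1T\sum_{t=1}^T\log p(y_t\mid y_{t-1},\dots,y_1;\beta)$$ and let $Q_T(\theta,\beta)$ be the same function of the simulated path $\tilde y_1(\theta),\dots,\tilde y_T(\theta)$. Let $g:\Theta\to\mathbb R^q$ be twice continuously differentiable with $\mathrm{rank}(\partial g(\theta^0)/\partial\theta')=q$ (so $q\le d$). The constrained estimator $\hat\beta_T^r$ solves, with probability tending to one, the first-order conditions of $\max Q_T(\beta)$ subject to $g(\beta)=0$: $\hat\beta^r_T\in\mathrm{Int}(\Theta)$, $g(\hat\beta_T^r)=0$ and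 $\frac{\partial Q_T(\hat\beta_T^r)}{\partial\beta}+\frac{\partial g'(\hat\beta_T^r)}{\partial\beta}\hat\lambda_T=0$ for some $\hat\lambda_T\in\mathbb R^q$. The pseudo-true value $\beta^0\in\mathrm{Int}(\Theta)$ is the asymptotically unique maximizer of this program: $g(\beta^0)=0$, and for every other $\beta\in\mathrm{Int}(\Theta)$ with $g(\beta)=0$ there is $\delta>0$ with $\Pr\{Q_T(\beta^0)\ge Q_T(\beta)+\delta\}\to1$. Assumptions. (A1$'$) Almost surely, $Q_T$ is well defined (the densities do not vanish) and twice continuously differentiable on $\mathrm{Int}(\Theta)$; (i) $\sqrt T\,[\partial Q_T(\beta^0)/\partial\beta-L(\theta^0,\beta^0)]\to_d N(0,\mathcal I^0)$; (ii) $\partial^2Q_T(\beta_T^*)/\partial\beta\partial\beta'\to-\mathcal J^0$ in probability for all random $\beta_T^*\in\mathrm{Int}(\Theta)$ with $\beta_T^*-\beta^0=o_P(1)$; here $\mathcal I^0$ and $\mathcal J^0$ are non-random positive definite matrices. (A2$'$) $\sqrt T(\hat\beta_T^r-\beta^0)=O_P(1)$. (A3) For each $\theta\in\Theta$, almost surely,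 $\beta\mapsto Q_T(\theta,\beta)$ is well defined (the densities do not vanish) and twice continuously differentiable on $\mathrm{Int}(\Theta)$; for each $\beta\in\mathrm{Int}(\Theta)$ with $g(\beta)=0$, almost surely, $\theta\mapsto\partial Q_T(\theta,\beta)/\partial\beta$ is continuous on $\Theta$. (A4) There are a vector function $L(\theta,\beta^0)$ and a matrix function $\mathcal J(\theta,\beta^0)$ with positive definite values such that, for every $\gamma>0$, $$\sup_{\theta\in\Theta}\ \sup_{\|\beta-\beta^0\|\le\gamma/\sqrt T}\left\|\frac{\partial Q_T(\theta,\beta)}{\partial\beta}-L(\theta,\beta^0)\right\|=o_P(1),\qquad \sup_{\theta\in\Theta}\ \sup_{\|\beta-\beta^0\|\le\gamma/\sqrt T}\left\|\frac{\partial^2 Q_T(\theta,\beta)}{\partial\beta\,\partial\beta'}+\mathcal J(\theta,\beta^0)\right\|=o_P(1).$$ (A6) $\theta\mapsto L(\theta,\beta^0)$ is continuously differentiable on $\mathrm{Int}(\Theta)$ and $\mathrm{rank}(\partial L(\theta^0,\beta^0)/\partial\theta')=d$. Conclusion. Let $$\hat\beta_T=\hat\beta_T^r-\left[\frac{\partial^2Q_T(\hat\beta_T^r)}{\partial\beta\,\partial\beta'}\right]^{-1}\frac{\partial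 Q_T(\hat\beta_T^r)}{\partial\beta}$$ be the FUNC (feasible unconstrained Newton-Raphson) estimator. Under the null hypothesis $g(\theta^0)=0$, the score test statistic $$\xi_T=-T\,(\hat\beta_T-\hat\beta_T^r)'\left[\frac{\partial^2Q_T(\hat\beta_T^r)}{\partial\beta\,\partial\beta'}\right](\hat\beta_T-\hat\beta_T^r)$$ converges in distribution to $\chi^2_q$. (On the event, of probability tending to zero, that $\hat\beta_T^r\notin\mathrm{Int}(\Theta)$, where the derivatives are not defined, put $\xi_T=0$.) -/

import Mathlib

open MeasureTheory ProbabilityTheory Filter Topology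

namespace ScoreTest

/-- The parameter space is a subset of `ℝ^d` with the Euclidean norm. -/
abbrev Par (d : ℕ) : Type := EuclideanSpace ℝ (Fin d)

section Model

variable {𝒴 : Type*} [MeasurableSpace 𝒴] {d q : ℕ}

/-- `p t x y θ` is the conditional density at `y`, with respect to `ν`, of the observation that
comes after the `t` observations `x`, under the parameter `θ ∈ Θ`. -/
def IsCondDensityFamily (ν : Measure 𝒴) (Θ : Set (Par d))
    (p : (t : ℕ) → (Fin t → 𝒴) → 𝒴 → Par d → ℝ) : Prop :=
  ∀ θ ∈ Θ, ∀ t : ℕ,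
    Measurable (fun z : (Fin t → 𝒴) × 𝒴 => p t z.1 z.2 θ) ∧
    (∀ x y, 0 ≤ p t x y θ) ∧
    ∀ x, ∫⁻ y, ENNReal.ofReal (p t x y θ) ∂ν = 1

/-- The conditional density, at the parameter `θ`, of the observation `y i` of a sample `y` given
the observations that precede it in the sample. -/
def obsDensity (p : (t : ℕ) → (Fin t → 𝒴) → 𝒴 → Par d → ℝ) {T : ℕ} (y : Fin T → 𝒴)
    (θ : Par d) (i : Fin T) : ℝ :=
  p i (fun j => y (Fin.castLE i.2.le j)) (y i) θ

/-- The law of a sample of size `T` under the parameter `θ`: its density is the product of the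
conditional densities. -/
noncomputable def sampleLaw (ν : Measure 𝒴) (p : (t : ℕ) → (Fin t → 𝒴) → 𝒴 → Par d → ℝ)
    (T : ℕ) (θ : Par d) : Measure (Fin T → 𝒴) :=
  (Measure.pi fun _ => ν).withDensity
    fun y => ∏ i, ENNReal.ofReal (obsDensity p y θ i)

/-- The criterion: the average log-likelihood of the sample `y` at `β`. -/
noncomputable def crit (p : (t : ℕ) → (Fin t → 𝒴) → 𝒴 → Par d → ℝ) {T : ℕ} (y : Fin T → 𝒴)
    (β : Par d) : ℝ :=
  (T : ℝ)⁻¹ * ∑ i, Real.log (obsDensity p y β i)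

/-- The gradient of the criterion in `β`. -/
noncomputable def score (p : (t : ℕ) → (Fin t → 𝒴) → 𝒴 → Par d → ℝ) {T : ℕ} (y : Fin T → 𝒴)
    (β : Par d) : Par d :=
  gradient (crit p y) β

/-- The Hessian of the criterion in `β`, as a linear map. -/
noncomputable def hess (p : (t : ℕ) → (Fin t → 𝒴) → 𝒴 → Par d → ℝ) {T : ℕ} (y : Fin T → 𝒴)
    (β : Par d) : Par d →L[ℝ] Par d :=
  fderiv ℝ (score p y) β

/-- For the sample `y`, the log-likelihood is well defined (no density vanishes) and twice
continuously differentiable on the interior of `Θ`. -/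
def IsSmoothSample (Θ : Set (Par d)) (p : (t : ℕ) → (Fin t → 𝒴) → 𝒴 → Par d → ℝ) {T : ℕ}
    (y : Fin T → 𝒴) : Prop :=
  (∀ β ∈ interior Θ, ∀ i, 0 < obsDensity p y β i) ∧ ContDiffOn ℝ 2 (crit p y) (interior Θ)

/-- The linear map of a matrix. -/
noncomputable abbrev matMap (A : Matrix (Fin d) (Fin d) ℝ) : Par d →L[ℝ] Par d :=
  Matrix.toEuclideanCLM (n := Fin d) (𝕜 := ℝ) A

/-- The feasible unconstrained Newton-Raphson (FUNC) estimator: one Newton step from `b`. -/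
noncomputable def func (p : (t : ℕ) → (Fin t → 𝒴) → 𝒴 → Par d → ℝ) {T : ℕ} (y : Fin T → 𝒴)
    (b : Par d) : Par d :=
  b - (hess p y b).inverse (score p y b)

/-- The score test statistic computed from the constrained estimate `b`. The derivatives of the
criterion exist in the interior of `Θ` only; the statistic is `0` if `b` is not there. -/
noncomputable def scoreStat (Θ : Set (Par d)) (p : (t : ℕ) → (Fin t → 𝒴) → 𝒴 → Par d → ℝ)
    {T : ℕ} (y : Fin T → 𝒴) (b : Par d) : ℝ :=
  (interior Θ).indicator
    (fun b => -((T : ℝ) * inner ℝ (func p y b - b) (hess p y b (func p y b - b)))) b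

variable {Ω : Type*} [MeasurableSpace Ω]

/-- The first `T` observations of a process. -/
def sample (Y : ℕ → Ω → 𝒴) (T : ℕ) (ω : Ω) : Fin T → 𝒴 := fun i => Y i ω

/-- `√T (b_T - β₀) = O_P(1)`. -/
def IsRootConsistent (P : Measure Ω) (b : ℕ → Ω → Par d) (β₀ : Par d) : Prop :=
  ∀ ε : ENNReal, 0 < ε → ∃ M : ℝ, ∀ᶠ T : ℕ in atTop,
    P {ω | M < √(T : ℝ) * ‖b T ω - β₀‖} ≤ ε

/-- `b T` is, with probability tending to one, a solution in the interior of `Θ` of the first-order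
conditions of the program that maximizes the criterion subject to `g = 0`. -/
def IsConstrainedEstimator (P : Measure Ω) (Θ : Set (Par d))
    (p : (t : ℕ) → (Fin t → 𝒴) → 𝒴 → Par d → ℝ) (g : Par d → EuclideanSpace ℝ (Fin q))
    (Y : ℕ → Ω → 𝒴) (b : ℕ → Ω → Par d) : Prop :=
  (∀ T, AEMeasurable (b T) P) ∧
  Tendsto (fun T : ℕ => P {ω | ¬ (b T ω ∈ interior Θ ∧ g (b T ω) = 0 ∧
    ∃ l : EuclideanSpace ℝ (Fin q),
      score p (sample Y T ω) (b T ω) +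
        ContinuousLinearMap.adjoint (fderiv ℝ g (b T ω)) l = 0)}) atTop (𝓝 0)

/-- `β₀` is the pseudo-true value of the constrained program: it is feasible and, asymptotically,
the criterion is larger at `β₀` than at any other feasible point, by a positive constant. (If the
criterion has a limit in probability, this says that `β₀` is the unique maximizer of that limit
subject to the constraints.) -/
def IsPseudoTrue (P : Measure Ω) (Θ : Set (Par d))
    (p : (t : ℕ) → (Fin t → 𝒴) → 𝒴 → Par d → ℝ) (g : Par d → EuclideanSpace ℝ (Fin q))
    (Y : ℕ → Ω → 𝒴) (β₀ : Par d) : Prop :=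
  β₀ ∈ interior Θ ∧ g β₀ = 0 ∧
  ∀ β ∈ interior Θ, g β = 0 → β ≠ β₀ → ∃ δ : ℝ, 0 < δ ∧
    Tendsto (fun T : ℕ => P {ω | crit p (sample Y T ω) β₀ < crit p (sample Y T ω) β + δ})
      atTop (𝓝 0)

/-- Regularity of the observed criterion: smoothness, asymptotic normality of the score at the
pseudo-true value around `L₀`, and convergence of the Hessian to `-J₀` along every consistent
sequence of random points. -/
structure ObservedRegularity (P : Measure Ω) [IsProbabilityMeasure P] (Θ : Set (Par d))
    (p : (t : ℕ) → (Fin t → 𝒴) → 𝒴 → Par d → ℝ) (Y : ℕ → Ω → 𝒴) (β₀ L₀ : Par d)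
    (I₀ J₀ : Matrix (Fin d) (Fin d) ℝ) : Prop where
  smooth : ∀ T, ∀ᵐ ω ∂P, IsSmoothSample Θ p (sample Y T ω)
  posDef_I : I₀.PosDef
  posDef_J : J₀.PosDef
  score_clt : TendstoInDistribution
    (fun (T : ℕ) ω => √(T : ℝ) • (score p (sample Y T ω) β₀ - L₀)) atTop
    id (fun _ => P) (multivariateGaussian 0 I₀)
  hess_lim : ∀ b : ℕ → Ω → Par d, (∀ T, AEMeasurable (b T) P) → (∀ T ω, b T ω ∈ interior Θ) →
    TendstoInMeasure P b atTop (fun _ => β₀) →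
    TendstoInMeasure P (fun T ω => hess p (sample Y T ω) (b T ω)) atTop (fun _ => -matMap J₀)

/-- Regularity of the simulated criterion: smoothness in `β`, and continuity in `θ` of the
simulated score at the points `β` that satisfy the constraints. -/
structure SimulatedRegularity (P : Measure Ω) (Θ : Set (Par d))
    (p : (t : ℕ) → (Fin t → 𝒴) → 𝒴 → Par d → ℝ) (g : Par d → EuclideanSpace ℝ (Fin q))
    (Ysim : Par d → ℕ → Ω → 𝒴) : Prop where
  smooth : ∀ θ ∈ Θ, ∀ T, ∀ᵐ ω ∂P, IsSmoothSample Θ p (sample (Ysim θ) T ω)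
  score_cont : ∀ β ∈ interior Θ, g β = 0 → ∀ T, ∀ᵐ ω ∂P,
    ContinuousOn (fun θ => score p (sample (Ysim θ) T ω) β) Θ

/-- Uniform convergence in probability of the simulated score and Hessian, over `θ ∈ Θ` and over
`β` in the balls of radius `γ / √T` around `β₀`. A supremum exceeds `ε` exactly if one of the
values does, and `P` of a set that is not measurable is its outer probability. -/
structure SimulatedLimits (P : Measure Ω) (Θ : Set (Par d))
    (p : (t : ℕ) → (Fin t → 𝒴) → 𝒴 → Par d → ℝ) (Ysim : Par d → ℕ → Ω → 𝒴) (β₀ : Par d)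
    (L : Par d → Par d) (J : Par d → Matrix (Fin d) (Fin d) ℝ) : Prop where
  score_lim : ∀ γ : ℝ, 0 < γ → ∀ ε : ℝ, 0 < ε → Tendsto (fun T : ℕ =>
    P {ω | ∃ θ ∈ Θ, ∃ β, ‖β - β₀‖ ≤ γ / √(T : ℝ) ∧
      ε < ‖score p (sample (Ysim θ) T ω) β - L θ‖}) atTop (𝓝 0)
  posDef_J : ∀ θ ∈ Θ, (J θ).PosDef
  hess_lim : ∀ γ : ℝ, 0 < γ → ∀ ε : ℝ, 0 < ε → Tendsto (fun T : ℕ =>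
    P {ω | ∃ θ ∈ Θ, ∃ β, ‖β - β₀‖ ≤ γ / √(T : ℝ) ∧
      ε < ‖hess p (sample (Ysim θ) T ω) β + matMap (J θ)‖}) atTop (𝓝 0)

end Model

/-- The chi-squared distribution with `q` degrees of freedom: the law of the sum of the squares of
`q` independent standard normal variables. -/
noncomputable def chiSquared (q : ℕ) : Measure ℝ :=
  (Measure.pi fun _ : Fin q => gaussianReal 0 1).map fun z => ∑ i, z i ^ 2

instance isProbabilityMeasure_chiSquared (q : ℕ) : IsProbabilityMeasure (chiSquared q) :=
  Measure.isProbabilityMeasure_map (Measurable.aemeasurable (by fun_prop))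

end ScoreTest

/-! Write `z` for the root-`T` score at the true value, `u` for the rescaled error of the
constrained estimate, `A` for the limit of minus the Hessian and `G` for the derivative of the
constraints. The first-order conditions linearize to `G u = 0` with `w = z - A u` in the range of
the adjoint of `G`, and the statistic is close to `⟨A⁻¹ w, w⟩`. Since `G A⁻¹ w = G A⁻¹ z`, this
equals `‖M z‖²` with `M = (G A⁻¹ G*)^(-1/2) G A⁻¹`, and `M A M*` is the identity
(`exists_standardizing_map`). A compactness argument absorbs the linearization errors without any
bound on the multiplier (`exists_delta_quadratic`, `ObservedRegularity.scoreStat_sub_lim`).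

For the limit to be chi-squared, `z` must be asymptotically centered Gaussian with covariance `A`.
No such property is assumed; it is extracted from the likelihood structure. A likelihood ratio has
mean at most one under the law in its denominator, so by Markov's inequality its logarithm is rarely
large (`measure_le_logRatio_le`). Hence the true value cannot lose to another point by a positive
constant, and the pseudo-true value is the true one (`IsPseudoTrue.eq_of_null`); a nonzero score
limit would make a local log-likelihood ratio explode, so it vanishes
(`ObservedRegularity.limit_eq_zero`).

The information equality (`ObservedRegularity.information_eq`) holds because the ratio at the local
parameter `h` tends in law to `exp (⟨h, Z⟩ - ⟨h, A h⟩ / 2)` with `Z` Gaussian of covariance `I₀`,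
and this limit has mean one. Mean at most one is Fatou's lemma; the reverse needs the log-ratio to
be bounded above in probability under the local alternatives
(`SimulatedLimits.localLogRatio_tight`). There the uniform Hessian limit controls the second
difference over `0, h, 2h`, and Markov's inequality controls the ratio of `2h` to `h`. The limiting
Hessian is not assumed continuous in the parameter; its boundedness near the true value comes from
lower semicontinuity of the sample laws (`SimulatedLimits.exists_bound`). -/

namespace ScoreTest

/-! ### Measurability of random functions and measurable selection. -/

section RandomFunctions

/-- A linear map is assembled continuously from its values at the standard basis. -/
lemma clm_eq_sum_smulRight {d : ℕ} {G : Type*} [NormedAddCommGroup G] [NormedSpace ℝ G]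
    (A : Par d →L[ℝ] G) :
    A = ∑ i, (EuclideanSpace.proj i : Par d →L[ℝ] ℝ).smulRight
      (A (EuclideanSpace.single i 1)) := by
  ext x
  have hx : x = ∑ i, x i • EuclideanSpace.single i (1 : ℝ) := by
    ext j
    simp [Finset.sum_apply, Pi.single_apply]
  conv_lhs => rw [hx]
  simp [map_sum]

variable {Ω : Type*} [MeasurableSpace Ω] {P : Measure Ω} {d : ℕ}
  {G : Type*} [NormedAddCommGroup G] [MeasurableSpace G] [BorelSpace G]

/-- The directional derivatives of a random function are measurable. -/
lemma aemeasurable_fderiv_apply [NormedSpace ℝ G] [SecondCountableTopology G] {F : Ω → Par d → G} {U : Set (Par d)}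
    (hU : IsOpen U) (hF : ∀ x ∈ U, AEMeasurable (fun ω => F ω x) P) {x : Par d} (hx : x ∈ U)
    (hd : ∀ᵐ ω ∂P, DifferentiableAt ℝ (F ω) x) (v : Par d) :
    AEMeasurable (fun ω => fderiv ℝ (F ω) x v) P := by
  have h1 : Tendsto (fun c : ℝ => x + c⁻¹ • v) atTop (𝓝 x) := by
    have : Tendsto (fun c : ℝ => x + c⁻¹ • v) atTop (𝓝 (x + (0 : ℝ) • v)) :=
      tendsto_const_nhds.add (tendsto_inv_atTop_zero.smul_const v)
    simpa using this
  have h2 : ∀ᶠ n : ℕ in atTop, x + ((n : ℝ))⁻¹ • v ∈ U :=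
    (h1.comp tendsto_natCast_atTop_atTop).eventually (hU.mem_nhds hx)
  obtain ⟨N, hN⟩ := eventually_atTop.1 h2
  -- The derivative is an a.e. limit of difference quotients; the shift by `N` keeps every
  -- evaluation point in `U`.
  refine aemeasurable_of_tendsto_metrizable_ae' (f := fun (n : ℕ) ω =>
    (((n + N : ℕ) : ℝ)) • (F ω (x + (((n + N : ℕ) : ℝ))⁻¹ • v) - F ω x)) ?_ ?_
  · intro n
    exact ((hF _ (hN _ (Nat.le_add_left _ _))).sub (hF x hx)).const_smul _
  · filter_upwards [hd] with ω hω
    exact ((hω.hasFDerivAt.lim_real v).comp tendsto_natCast_atTop_atTop).comp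
      (tendsto_add_atTop_nat N)

lemma aemeasurable_clm [NormedSpace ℝ G] [SecondCountableTopology G] [MeasurableSpace (Par d →L[ℝ] G)]
    [BorelSpace (Par d →L[ℝ] G)] {A : Ω → Par d →L[ℝ] G}
    (hA : ∀ v, AEMeasurable (fun ω => A ω v) P) : AEMeasurable A P := by
  have h1 : Continuous (fun w : Fin d → G =>
      ∑ i, (EuclideanSpace.proj i : Par d →L[ℝ] ℝ).smulRight (w i)) := by
    refine continuous_finsetSum _ fun i _ => ?_
    exact ((ContinuousLinearMap.smulRightL ℝ (Par d) G
      (EuclideanSpace.proj i)).continuous).comp (continuous_apply i)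
  have h2 : AEMeasurable (fun ω i => A ω (EuclideanSpace.single i (1 : ℝ))) P :=
    aemeasurable_pi_lambda _ fun i => hA _
  refine (h1.measurable.comp_aemeasurable h2).congr (ae_of_all _ fun ω => ?_)
  exact (clm_eq_sum_smulRight (A ω)).symm

lemma aemeasurable_fderiv [NormedSpace ℝ G] [SecondCountableTopology G] [MeasurableSpace (Par d →L[ℝ] G)]
    [BorelSpace (Par d →L[ℝ] G)] {F : Ω → Par d → G} {U : Set (Par d)}
    (hU : IsOpen U) (hF : ∀ x ∈ U, AEMeasurable (fun ω => F ω x) P) {x : Par d} (hx : x ∈ U)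
    (hd : ∀ᵐ ω ∂P, DifferentiableAt ℝ (F ω) x) :
    AEMeasurable (fun ω => fderiv ℝ (F ω) x) P :=
  aemeasurable_clm fun v => aemeasurable_fderiv_apply hU hF hx hd v

/-- A random continuous function evaluated at a random point is measurable. -/
lemma aemeasurable_indicator_eval {F : Ω → Par d → G} {U : Set (Par d)}
    (hU : IsOpen U) (hF : ∀ x ∈ U, AEMeasurable (fun ω => F ω x) P)
    (hc : ∀ᵐ ω ∂P, ContinuousOn (F ω) U) {b : Ω → Par d} (hb : AEMeasurable b P) :
    AEMeasurable (fun ω => U.indicator (F ω) (b ω)) P := by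
  classical
  rcases U.eq_empty_or_nonempty with rfl | ⟨y₀, hy₀⟩
  · simp
  obtain ⟨b', hb', hbb⟩ := hb
  -- Moving the point into `U` everywhere allows approximation by simple functions with values in
  -- `U`.
  set c : Ω → Par d := fun ω => if b' ω ∈ U then b' ω else y₀ with hcdef
  have hcm : Measurable c := Measurable.ite (hb' hU.measurableSet) hb' measurable_const
  have hcU : ∀ ω, c ω ∈ U := by
    intro ω
    simp only [hcdef]
    split_ifs with h
    · exact h
    · exact hy₀
  let s : ℕ → SimpleFunc Ω (Par d) := SimpleFunc.approxOn c hcm U y₀ hy₀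
  have hsU : ∀ n ω, s n ω ∈ U := fun n ω => SimpleFunc.approxOn_mem hcm hy₀ n ω
  have hsm : ∀ n, AEMeasurable (fun ω => F ω (s n ω)) P := by
    intro n
    -- Each value `x` has its own null set; a simple function takes finitely many values, so their
    -- union is still null.
    let m : Par d → Ω → G := fun x =>
      if h : x ∈ U then (hF x h).mk (fun ω => F ω x) else fun _ => 0
    have hm : ∀ x, Measurable (m x) := by
      intro x
      by_cases h : x ∈ U
      · simpa [m, h] using (hF x h).measurable_mk
      · simp [m, h, measurable_const]
    refine ⟨fun ω => m (s n ω) ω, SimpleFunc.measurable_bind (s n) m hm, ?_⟩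
    have : ∀ᵐ ω ∂P, ∀ x ∈ (s n).range, x ∈ U → F ω x = m x ω := by
      refine (Finset.eventually_all _).2 fun x _ => ?_
      by_cases h : x ∈ U
      · filter_upwards [(hF x h).ae_eq_mk] with ω hω _
        simpa [m, h] using hω
      · exact ae_of_all _ fun ω h' => absurd h' h
    filter_upwards [this] with ω hω
    exact hω _ ((s n).mem_range_self ω) (hsU n ω)
  have hlim : AEMeasurable (fun ω => F ω (c ω)) P := by
    refine aemeasurable_of_tendsto_metrizable_ae' hsm ?_
    filter_upwards [hc] with ω hω
    exact (hω.continuousAt (hU.mem_nhds (hcU ω))).tendsto.comp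
      (SimpleFunc.tendsto_approxOn hcm hy₀ (subset_closure (hcU ω)))
  refine (hlim.indicator (hb' hU.measurableSet)).congr ?_
  filter_upwards [hbb] with ω hω
  rw [hω]
  by_cases h : b' ω ∈ U
  · simp [hcdef, Set.indicator, h]
  · simp [Set.indicator, h]

/-- If a random continuous function exceeds a level somewhere in a set, then it does so at a
point of this set that is chosen measurably. -/
lemma exists_measurable_point_of_exceed {f : Ω → Par d → ℝ} {S : Set (Par d)}
    (hne : S.Nonempty) (hf : ∀ x ∈ S, AEMeasurable (fun ω => f ω x) P)
    (hc : ∀ᵐ ω ∂P, ContinuousOn (f ω) S) (ε : ℝ) :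
    ∃ b : Ω → Par d, Measurable b ∧ (∀ ω, b ω ∈ S) ∧
      ∀ᵐ ω ∂P, (∃ x ∈ S, ε < f ω x) → ε < f ω (b ω) := by
  classical
  have : Nonempty S := hne.to_subtype
  let x : ℕ → S := TopologicalSpace.denseSeq S
  have hx : DenseRange x := TopologicalSpace.denseRange_denseSeq S
  let m : ℕ → Ω → ℝ := fun n => (hf (x n) (x n).2).mk _
  have hm : ∀ n, Measurable (m n) := fun n => (hf (x n) (x n).2).measurable_mk
  have hA : ∀ n, MeasurableSet {ω | ε < m n ω} := fun n => measurableSet_lt measurable_const (hm n)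
  -- The selected point is the first one of a dense sequence that exceeds the level; the second
  -- alternative makes the search stop at `0` if none does. By continuity, an exceedance anywhere
  -- forces one on the dense sequence.
  let p : Ω → ℕ → Prop := fun ω n => ε < m n ω ∨ ∀ k, ¬ ε < m k ω
  have hp : ∀ ω, ∃ n, p ω n := by
    intro ω
    by_cases h : ∃ n, ε < m n ω
    · obtain ⟨n, hn⟩ := h
      exact ⟨n, Or.inl hn⟩
    · exact ⟨0, Or.inr (not_exists.1 h)⟩
  have hpm : ∀ n, MeasurableSet {ω | p ω n} := by
    intro n
    have : {ω | p ω n} = {ω | ε < m n ω} ∪ ⋂ k, {ω | ε < m k ω}ᶜ := by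
      ext ω
      simp [p]
    rw [this]
    exact (hA n).union (MeasurableSet.iInter fun k => (hA k).compl)
  refine ⟨fun ω => x (Nat.find (hp ω)), ?_, fun ω => (x _).2, ?_⟩
  · exact (measurable_from_top (f := fun n => ((x n : Par d)))).comp (measurable_find hp hpm)
  · have hmk : ∀ᵐ ω ∂P, ∀ n, f ω (x n) = m n ω := ae_all_iff.2 fun n => (hf (x n) (x n).2).ae_eq_mk
    filter_upwards [hmk, hc] with ω h1 h2 h3
    obtain ⟨y, hyS, hy⟩ := h3
    have hcont : Continuous (fun z : S => f ω z) := continuousOn_iff_continuous_domRestrict.1 h2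
    obtain ⟨n, hn⟩ := hx.exists_mem_open (isOpen_lt continuous_const hcont) ⟨⟨y, hyS⟩, hy⟩
    have hspec := Nat.find_spec (hp ω)
    rcases hspec with h | h
    · rw [h1]
      exact h
    · exact absurd (by rw [← h1]; exact hn) (h n)

end RandomFunctions

/-! ### Events of high probability and boundedness in probability. -/

section HighProbability

variable {Ω : Type*} [MeasurableSpace Ω] {P : Measure Ω}

/-- The events `A T` have (outer) probability tending to one. -/
def WithHighProb (P : Measure Ω) (A : ℕ → Ω → Prop) : Prop :=
  Tendsto (fun T => P {ω | ¬ A T ω}) atTop (𝓝 0)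

lemma WithHighProb.mono {A B : ℕ → Ω → Prop} (hA : WithHighProb P A)
    (h : ∀ᶠ T in atTop, ∀ᵐ ω ∂P, A T ω → B T ω) : WithHighProb P B := by
  refine tendsto_of_tendsto_of_tendsto_of_le_of_le' tendsto_const_nhds hA
    (Eventually.of_forall fun _ => zero_le) ?_
  filter_upwards [h] with T hT
  refine measure_mono_ae ?_
  filter_upwards [hT] with ω hω hB hA'
  exact hB (hω hA')

lemma WithHighProb.and {A B : ℕ → Ω → Prop} (hA : WithHighProb P A) (hB : WithHighProb P B) :
    WithHighProb P fun T ω => A T ω ∧ B T ω := by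
  have h : Tendsto (fun T => P {ω | ¬ A T ω} + P {ω | ¬ B T ω}) atTop (𝓝 0) := by
    simpa using Tendsto.add hA hB
  refine tendsto_of_tendsto_of_tendsto_of_le_of_le tendsto_const_nhds h (fun _ => zero_le) ?_
  intro T
  refine (measure_mono ?_).trans (measure_union_le _ _)
  intro ω hω
  simp only [Set.mem_ofPred_eq, Set.mem_union] at hω ⊢
  tauto

lemma WithHighProb.of_eventually_ae {A : ℕ → Ω → Prop}
    (h : ∀ᶠ T in atTop, ∀ᵐ ω ∂P, A T ω) : WithHighProb P A := by
  refine Tendsto.congr' ?_ tendsto_const_nhds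
  filter_upwards [h] with T hT
  exact (ae_iff.1 hT).symm

lemma WithHighProb.eventually_exists [IsProbabilityMeasure P] {A : ℕ → Ω → Prop}
    (h : WithHighProb P A) : ∀ᶠ T in atTop, ∃ ω, A T ω := by
  filter_upwards [h.eventually_lt_const (zero_lt_one)] with T hT
  by_contra hcon
  push Not at hcon
  have : {ω | ¬ A T ω} = Set.univ := Set.eq_univ_of_forall hcon
  rw [this, measure_univ] at hT
  exact lt_irrefl _ hT

/-- Boundedness in probability. -/
def BoundedInProb {E : Type*} [Norm E] (P : Measure Ω) (X : ℕ → Ω → E) : Prop :=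
  ∀ ε : ENNReal, 0 < ε → ∃ M : ℝ, ∀ᶠ T in atTop, P {ω | M < ‖X T ω‖} ≤ ε

/-- A property holds with high probability if, for every level `M`, it is a consequence of a
bound `M` on a sequence that is bounded in probability and of events of high probability. -/
lemma WithHighProb.of_bounded {E : Type*} [Norm E] {X : ℕ → Ω → E} {A : ℕ → Ω → Prop}
    (hX : BoundedInProb P X)
    (h : ∀ M : ℝ, WithHighProb P fun T ω => ‖X T ω‖ ≤ M → A T ω) : WithHighProb P A := by
  refine ENNReal.tendsto_nhds_zero.2 fun ε hε => ?_
  obtain ⟨M, hM⟩ := hX (ε / 2) (ENNReal.half_pos hε.ne')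
  filter_upwards [hM, ENNReal.tendsto_nhds_zero.1 (h M) (ε / 2) (ENNReal.half_pos hε.ne')]
    with T h1 h2
  rw [← ENNReal.add_halves ε]
  refine le_trans (measure_mono ?_) ((measure_union_le {ω | M < ‖X T ω‖} _).trans
    (add_le_add h1 h2))
  intro ω hω
  simp only [Set.mem_ofPred_eq, Set.mem_union] at hω ⊢
  rcases lt_or_ge M ‖X T ω‖ with h' | h'
  · exact Or.inl h'
  · exact Or.inr fun hc => hω (hc h')

lemma tendstoInMeasure_iff_withHighProb {E : Type*} [SeminormedAddCommGroup E]
    {X : ℕ → Ω → E} {Z : Ω → E} :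
    TendstoInMeasure P X atTop Z ↔
      ∀ ε : ℝ, 0 < ε → WithHighProb P fun T ω => ‖X T ω - Z ω‖ < ε := by
  simp only [tendstoInMeasure_iff_norm, WithHighProb, not_lt]

/-- A sequence that converges in distribution is bounded in probability. -/
lemma BoundedInProb.of_tendstoInDistribution {E : Type*} [NormedAddCommGroup E]
    [MeasurableSpace E] [BorelSpace E] [IsProbabilityMeasure P]
    {Ω' : Type*} [MeasurableSpace Ω'] {P' : Measure Ω'} [IsProbabilityMeasure P']
    {X : ℕ → Ω → E} {Z : Ω' → E}
    (h : TendstoInDistribution X atTop Z (fun _ => P) P') : BoundedInProb P X := by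
  intro ε hε
  -- The tails are closed, as the portmanteau bound on the limsup requires.
  let F : ℕ → Set E := fun M => {x | (M : ℝ) ≤ ‖x‖}
  have hFc : ∀ M, IsClosed (F M) := fun M => isClosed_le continuous_const continuous_norm
  have : IsProbabilityMeasure (P'.map Z) := Measure.isProbabilityMeasure_map h.aemeasurable_limit
  have hF : Tendsto (fun M => P'.map Z (F M)) atTop (𝓝 0) := by
    have hanti : Antitone F := by
      intro m n hmn x hx
      simp only [F, Set.mem_ofPred_eq] at hx ⊢
      exact le_trans (Nat.cast_le.2 hmn) hx
    have := tendsto_measure_iInter_atTop (μ := P'.map Z)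
      (fun M => (hFc M).measurableSet.nullMeasurableSet) hanti ⟨0, measure_ne_top _ _⟩
    have hempty : ⋂ M, F M = ∅ := by
      refine Set.eq_empty_of_forall_notMem fun x hx => ?_
      obtain ⟨n, hn⟩ := exists_nat_gt ‖x‖
      exact absurd (Set.mem_iInter.1 hx n) (not_le.2 hn)
    rwa [hempty, measure_empty] at this
  obtain ⟨M, hM⟩ := (hF.eventually_lt_const hε).exists
  refine ⟨M, ?_⟩
  have h1 := ProbabilityMeasure.limsup_measure_closed_le_of_tendsto h.tendsto (hFc M)
  have h2 := eventually_lt_of_limsup_lt (lt_of_le_of_lt h1 hM)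
  filter_upwards [h2] with T hT
  refine le_trans ?_ hT.le
  refine le_trans (measure_mono ?_) (Measure.le_map_apply (h.forall_aemeasurable T) (F M))
  intro ω hω
  simp only [F, Set.mem_preimage, Set.mem_ofPred_eq] at hω ⊢
  exact hω.le

end HighProbability

end ScoreTest

namespace ScoreTest

/-! ### The likelihood of a fixed sample. -/

section Pointwise

variable {𝒴 : Type*} {d : ℕ} {Θ : Set (Par d)}
  {p : (t : ℕ) → (Fin t → 𝒴) → 𝒴 → Par d → ℝ} {T : ℕ} {y : Fin T → 𝒴}

/-- The density of the law of a sample. -/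
noncomputable def pathDensity (p : (t : ℕ) → (Fin t → 𝒴) → 𝒴 → Par d → ℝ) {T : ℕ}
    (y : Fin T → 𝒴) (θ : Par d) : ENNReal :=
  ∏ i, ENNReal.ofReal (obsDensity p y θ i)

lemma pathDensity_eq_exp {θ : Par d} (h : ∀ i, 0 < obsDensity p y θ i) :
    pathDensity p y θ = ENNReal.ofReal (Real.exp (T * crit p y θ)) := by
  have h1 : (T : ℝ) * crit p y θ = ∑ i, Real.log (obsDensity p y θ i) := by
    rcases Nat.eq_zero_or_pos T with rfl | hT
    · simp
    · have : (T : ℝ) ≠ 0 := by positivity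
      rw [crit, ← mul_assoc, mul_inv_cancel₀ this, one_mul]
  rw [h1, Real.exp_sum, ENNReal.ofReal_prod_of_nonneg fun i _ => (Real.exp_pos _).le]
  exact Finset.prod_congr rfl fun i _ => by rw [Real.exp_log (h i)]

/-- The likelihood ratio transforms one density of a sample into another one. -/
lemma pathDensity_eq_ratio_mul {θ θ' : Par d}
    (h : ∀ i, 0 < obsDensity p y θ i) (h' : ∀ i, 0 < obsDensity p y θ' i) :
    pathDensity p y θ' =
      pathDensity p y θ * ENNReal.ofReal (Real.exp (T * (crit p y θ' - crit p y θ))) := by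
  rw [pathDensity_eq_exp h, pathDensity_eq_exp h', ← ENNReal.ofReal_mul (Real.exp_pos _).le,
    ← Real.exp_add]
  ring_nf

lemma score_eq (p : (t : ℕ) → (Fin t → 𝒴) → 𝒴 → Par d → ℝ) (y : Fin T → 𝒴) :
    score p y = fun β => (InnerProductSpace.toDual ℝ (Par d)).symm (fderiv ℝ (crit p y) β) := rfl

lemma IsSmoothSample.contDiffOn_score (h : IsSmoothSample Θ p y) :
    ContDiffOn ℝ 1 (score p y) (interior Θ) := by
  rw [score_eq]
  exact (InnerProductSpace.toDual ℝ (Par d)).symm.toContinuousLinearEquiv.contDiff.comp_contDiffOn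
    (h.2.fderiv_of_isOpen isOpen_interior (by norm_num))

lemma IsSmoothSample.hasGradientAt (h : IsSmoothSample Θ p y) {β : Par d} (hβ : β ∈ interior Θ) :
    HasGradientAt (crit p y) (score p y β) β :=
  ((h.2.contDiffAt (isOpen_interior.mem_nhds hβ)).differentiableAt (by norm_num)).hasGradientAt

lemma IsSmoothSample.hasFDerivAt_score (h : IsSmoothSample Θ p y) {β : Par d}
    (hβ : β ∈ interior Θ) : HasFDerivAt (score p y) (hess p y β) β :=
  ((h.contDiffOn_score.contDiffAt (isOpen_interior.mem_nhds hβ)).differentiableAt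
    (by norm_num)).hasFDerivAt

lemma IsSmoothSample.continuousOn_hess (h : IsSmoothSample Θ p y) :
    ContinuousOn (hess p y) (interior Θ) :=
  h.contDiffOn_score.continuousOn_fderiv_of_isOpen isOpen_interior le_rfl

lemma IsSmoothSample.continuousAt_crit (h : IsSmoothSample Θ p y) {β : Par d}
    (hβ : β ∈ interior Θ) : ContinuousAt (crit p y) β :=
  (h.2.contDiffAt (isOpen_interior.mem_nhds hβ)).continuousAt

lemma IsSmoothSample.tendsto_pathDensity (h : IsSmoothSample Θ p y) {β : Par d}
    (hβ : β ∈ interior Θ) {u : ℕ → Par d} (hu : Tendsto u atTop (𝓝 β)) :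
    Tendsto (fun n => pathDensity p y (u n)) atTop (𝓝 (pathDensity p y β)) := by
  have h1 : Tendsto (fun n => ENNReal.ofReal (Real.exp (T * crit p y (u n)))) atTop
      (𝓝 (ENNReal.ofReal (Real.exp (T * crit p y β)))) := by
    refine (ENNReal.continuous_ofReal.tendsto _).comp ((Real.continuous_exp.tendsto _).comp ?_)
    exact ((h.continuousAt_crit hβ).tendsto.comp hu).const_mul _
  rw [pathDensity_eq_exp (h.1 β hβ)]
  refine h1.congr' ?_
  filter_upwards [hu.eventually (isOpen_interior.mem_nhds hβ)] with n hn
  exact (pathDensity_eq_exp (h.1 _ hn)).symm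

end Pointwise

/-! ### Likelihood ratios under the sample laws. -/

section Likelihood

variable {𝒴 : Type*} [MeasurableSpace 𝒴] {d : ℕ} {ν : Measure 𝒴} {Θ : Set (Par d)}
  {p : (t : ℕ) → (Fin t → 𝒴) → 𝒴 → Par d → ℝ} {T : ℕ}

lemma sampleLaw_eq (θ : Par d) :
    sampleLaw ν p T θ = (Measure.pi fun _ => ν).withDensity fun y => pathDensity p y θ := rfl

lemma measurable_obsDensity (hp : IsCondDensityFamily ν Θ p) {θ : Par d} (hθ : θ ∈ Θ)
    (i : Fin T) : Measurable fun y : Fin T → 𝒴 => obsDensity p y θ i := by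
  have h1 := (hp θ hθ i).1
  have h2 : Measurable fun y : Fin T → 𝒴 =>
      ((fun j : Fin i => y (Fin.castLE i.2.le j)), y i) :=
    (measurable_pi_lambda _ fun j => measurable_pi_apply _).prodMk (measurable_pi_apply i)
  exact h1.comp h2

lemma measurable_pathDensity (hp : IsCondDensityFamily ν Θ p) {θ : Par d} (hθ : θ ∈ Θ) :
    Measurable fun y : Fin T → 𝒴 => pathDensity p y θ :=
  Finset.measurable_prod _ fun i _ => (measurable_obsDensity hp hθ i).ennreal_ofReal

lemma measurable_crit (hp : IsCondDensityFamily ν Θ p) {θ : Par d} (hθ : θ ∈ Θ) :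
    Measurable fun y : Fin T → 𝒴 => crit p y θ :=
  (Finset.measurable_sum _ fun i _ => (measurable_obsDensity hp hθ i).log).const_mul _

lemma measurableSet_obsDensity_pos (hp : IsCondDensityFamily ν Θ p) {θ : Par d} (hθ : θ ∈ Θ) :
    MeasurableSet {y : Fin T → 𝒴 | ∀ i, 0 < obsDensity p y θ i} := by
  have : {y : Fin T → 𝒴 | ∀ i, 0 < obsDensity p y θ i} =
      ⋂ i, {y | 0 < obsDensity p y θ i} := by
    ext y
    simp
  rw [this]
  exact MeasurableSet.iInter fun i =>
    measurableSet_lt measurable_const (measurable_obsDensity hp hθ i)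

variable {Ω : Type*} [MeasurableSpace Ω] {P : Measure Ω}

/-- The likelihood ratio integrates to at most one. -/
lemma lintegral_likelihoodRatio_le_one (hp : IsCondDensityFamily ν Θ p) {θ θ' : Par d}
    (hθ : θ ∈ Θ) (hθ' : θ' ∈ Θ) {X : Ω → Fin T → 𝒴} (hX : HasLaw X (sampleLaw ν p T θ) P)
    (hmass : sampleLaw ν p T θ' Set.univ ≤ 1)
    (hpos : ∀ᵐ ω ∂P, ∀ i, 0 < obsDensity p (X ω) θ i)
    (hpos' : ∀ᵐ ω ∂P, ∀ i, 0 < obsDensity p (X ω) θ' i) :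
    ∫⁻ ω, ENNReal.ofReal (Real.exp (T * (crit p (X ω) θ' - crit p (X ω) θ))) ∂P ≤ 1 := by
  let g : (Fin T → 𝒴) → ENNReal := fun y =>
    ENNReal.ofReal (Real.exp (T * (crit p y θ' - crit p y θ)))
  have hg : Measurable g :=
    ((((measurable_crit hp hθ').sub (measurable_crit hp hθ)).const_mul _).exp).ennreal_ofReal
  -- On `A` the ratio turns one density into the other. The law of `θ'` may charge the complement,
  -- so only an inequality is claimed.
  let A : Set (Fin T → 𝒴) := {y | ∀ i, 0 < obsDensity p y θ i} ∩ {y | ∀ i, 0 < obsDensity p y θ' i}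
  have hA : MeasurableSet A :=
    (measurableSet_obsDensity_pos hp hθ).inter (measurableSet_obsDensity_pos hp hθ')
  calc ∫⁻ ω, g (X ω) ∂P = ∫⁻ ω, A.indicator g (X ω) ∂P := by
        refine lintegral_congr_ae ?_
        filter_upwards [hpos, hpos'] with ω h1 h2
        exact (Set.indicator_of_mem (s := A) ⟨h1, h2⟩ g).symm
    _ = ∫⁻ y, A.indicator g y ∂(sampleLaw ν p T θ) :=
        hX.lintegral_comp (hg.indicator hA).aemeasurable
    _ = ∫⁻ y, pathDensity p y θ * A.indicator g y ∂(Measure.pi fun _ => ν) :=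
        lintegral_withDensity_eq_lintegral_mul _ (measurable_pathDensity hp hθ) (hg.indicator hA)
    _ ≤ ∫⁻ y, pathDensity p y θ' ∂(Measure.pi fun _ => ν) := by
        refine lintegral_mono fun y => ?_
        by_cases hy : y ∈ A
        · rw [Set.indicator_of_mem hy, pathDensity_eq_ratio_mul hy.1 hy.2]
        · simp [Set.indicator_of_notMem hy]
    _ = sampleLaw ν p T θ' Set.univ := by
        rw [sampleLaw_eq, withDensity_apply _ MeasurableSet.univ, Measure.restrict_univ]
    _ ≤ 1 := hmass

/-- The log-likelihood ratio is not much larger than zero. -/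
lemma measure_le_logRatio_le (hp : IsCondDensityFamily ν Θ p) {θ θ' : Par d}
    (hθ : θ ∈ Θ) (hθ' : θ' ∈ Θ) {X : Ω → Fin T → 𝒴} (hX : HasLaw X (sampleLaw ν p T θ) P)
    (hmass : sampleLaw ν p T θ' Set.univ ≤ 1)
    (hpos : ∀ᵐ ω ∂P, ∀ i, 0 < obsDensity p (X ω) θ i)
    (hpos' : ∀ᵐ ω ∂P, ∀ i, 0 < obsDensity p (X ω) θ' i) (c : ℝ) :
    P {ω | c ≤ T * (crit p (X ω) θ' - crit p (X ω) θ)} ≤ ENNReal.ofReal (Real.exp (-c)) := by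
  have h1 := lintegral_likelihoodRatio_le_one hp hθ hθ' hX hmass hpos hpos'
  have hm : AEMeasurable (fun ω =>
      ENNReal.ofReal (Real.exp (T * (crit p (X ω) θ' - crit p (X ω) θ)))) P :=
    ((((measurable_crit hp hθ').sub (measurable_crit hp hθ)).const_mul
      _).exp.ennreal_ofReal).comp_aemeasurable hX.aemeasurable
  -- Markov's inequality at the level `exp c`.
  have h2 := (mul_meas_ge_le_lintegral₀ hm (ENNReal.ofReal (Real.exp c))).trans h1
  have h3 : P {ω | c ≤ T * (crit p (X ω) θ' - crit p (X ω) θ)} =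
      ENNReal.ofReal (Real.exp (-c)) * (ENNReal.ofReal (Real.exp c) *
        P {ω | c ≤ T * (crit p (X ω) θ' - crit p (X ω) θ)}) := by
    rw [← mul_assoc, ← ENNReal.ofReal_mul (Real.exp_pos _).le, ← Real.exp_add]
    simp
  rw [h3]
  refine le_trans (mul_le_mul_right ?_ _) (mul_one _).le
  refine le_trans (mul_le_mul_right (measure_mono ?_) _) h2
  intro ω hω
  simp only [Set.mem_ofPred_eq] at hω ⊢
  exact ENNReal.ofReal_le_ofReal (Real.exp_le_exp.2 hω)

/-- A truncated likelihood ratio integrates to at least the probability, under the alternative,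
that it is not truncated. -/
lemma measure_logRatio_le_le_lintegral (hp : IsCondDensityFamily ν Θ p) {θ θ' : Par d}
    (hθ : θ ∈ Θ) (hθ' : θ' ∈ Θ) {X X' : Ω → Fin T → 𝒴} (hX : HasLaw X (sampleLaw ν p T θ) P)
    (hX' : HasLaw X' (sampleLaw ν p T θ') P)
    (hpos : ∀ᵐ ω ∂P, ∀ i, 0 < obsDensity p (X' ω) θ i)
    (hpos' : ∀ᵐ ω ∂P, ∀ i, 0 < obsDensity p (X' ω) θ' i) (m : ℝ) :
    P {ω | T * (crit p (X' ω) θ' - crit p (X' ω) θ) ≤ m} ≤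
      ∫⁻ ω, ENNReal.ofReal (Real.exp (min (T * (crit p (X ω) θ' - crit p (X ω) θ)) m)) ∂P := by
  let g : (Fin T → 𝒴) → ENNReal := fun y =>
    ENNReal.ofReal (Real.exp (min (T * (crit p y θ' - crit p y θ)) m))
  have hΛ : Measurable fun y : Fin T → 𝒴 => T * (crit p y θ' - crit p y θ) :=
    ((measurable_crit hp hθ').sub (measurable_crit hp hθ)).const_mul _
  have hg : Measurable g := (hΛ.min measurable_const).exp.ennreal_ofReal
  -- Both densities are a.s. positive under `θ'`, so restricting to `A` loses no probability there,
  -- and on `A` the truncation is inactive.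
  let A : Set (Fin T → 𝒴) := ({y | ∀ i, 0 < obsDensity p y θ i} ∩
    {y | ∀ i, 0 < obsDensity p y θ' i}) ∩ {y | T * (crit p y θ' - crit p y θ) ≤ m}
  have hA : MeasurableSet A :=
    ((measurableSet_obsDensity_pos hp hθ).inter (measurableSet_obsDensity_pos hp hθ')).inter
      (measurableSet_le hΛ measurable_const)
  calc P {ω | T * (crit p (X' ω) θ' - crit p (X' ω) θ) ≤ m} ≤ P {ω | X' ω ∈ A} := by
        refine measure_mono_ae ?_
        filter_upwards [hpos, hpos'] with ω h1 h2 h3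
        exact ⟨⟨h1, h2⟩, h3⟩
    _ = sampleLaw ν p T θ' A := by
        rw [← hX'.map_eq, Measure.map_apply_of_aemeasurable hX'.aemeasurable hA]
        rfl
    _ = ∫⁻ y in A, pathDensity p y θ' ∂(Measure.pi fun _ => ν) := by
        rw [sampleLaw_eq, withDensity_apply _ hA]
    _ ≤ ∫⁻ y in A, pathDensity p y θ * g y ∂(Measure.pi fun _ => ν) := by
        refine setLIntegral_mono' hA fun y hy => ?_
        have h3 : T * (crit p y θ' - crit p y θ) ≤ m := hy.2
        rw [pathDensity_eq_ratio_mul hy.1.1 hy.1.2]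
        simp only [g]
        rw [min_eq_left h3]
    _ ≤ ∫⁻ y, pathDensity p y θ * g y ∂(Measure.pi fun _ => ν) := setLIntegral_le_lintegral _ _
    _ = ∫⁻ y, g y ∂(sampleLaw ν p T θ) :=
        (lintegral_withDensity_eq_lintegral_mul _ (measurable_pathDensity hp hθ) hg).symm
    _ = ∫⁻ ω, g (X ω) ∂P := (hX.lintegral_comp hg.aemeasurable).symm

/-- Lower semicontinuity of the probability of an event in the parameter. -/
lemma sampleLaw_le_liminf (hp : IsCondDensityFamily ν Θ p) {θ : Par d} (hθ : θ ∈ Θ)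
    {u : ℕ → Par d} (hu : ∀ n, u n ∈ Θ) {X : Ω → Fin T → 𝒴}
    (hX : HasLaw X (sampleLaw ν p T θ) P)
    (hlim : ∀ᵐ ω ∂P, Tendsto (fun n => pathDensity p (X ω) (u n)) atTop
      (𝓝 (pathDensity p (X ω) θ)))
    {A : Set (Fin T → 𝒴)} (hA : MeasurableSet A) :
    sampleLaw ν p T θ A ≤ liminf (fun n => sampleLaw ν p T (u n) A) atTop := by
  have hmeas : ∀ n, Measurable fun y : Fin T → 𝒴 => pathDensity p y (u n) :=
    fun n => measurable_pathDensity hp (hu n)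
  let g : (Fin T → 𝒴) → ENNReal := fun y => liminf (fun n => pathDensity p y (u n)) atTop
  have hg : Measurable g := Measurable.liminf hmeas
  have hB : MeasurableSet {y : Fin T → 𝒴 | pathDensity p y θ ≤ g y} :=
    measurableSet_le (measurable_pathDensity hp hθ) hg
  have h1 : ∀ᵐ y ∂(sampleLaw ν p T θ), pathDensity p y θ ≤ g y := by
    rw [← hX.map_eq, ae_map_iff hX.aemeasurable hB]
    filter_upwards [hlim] with ω hω
    exact hω.liminf_eq.symm.le
  -- Where the density vanishes the bound is trivial, so it transfers from the sample law to the
  -- base measure. Fatou's lemma then concludes.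
  have h2 : ∀ᵐ y ∂(Measure.pi fun _ : Fin T => ν), pathDensity p y θ ≤ g y := by
    rw [sampleLaw_eq, ae_withDensity_iff (measurable_pathDensity hp hθ)] at h1
    filter_upwards [h1] with y hy
    by_cases h0 : pathDensity p y θ = 0
    · rw [h0]
      exact zero_le
    · exact hy h0
  simp only [sampleLaw_eq, withDensity_apply _ hA]
  exact (lintegral_mono_ae (ae_restrict_of_ae h2)).trans (lintegral_liminf_le hmeas)

end Likelihood

/-! ### Measurability of the score, the Hessian and the statistic. -/

section Derivatives

variable {𝒴 : Type*} [MeasurableSpace 𝒴] {d : ℕ} {ν : Measure 𝒴} {Θ : Set (Par d)}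
  {p : (t : ℕ) → (Fin t → 𝒴) → 𝒴 → Par d → ℝ} {T : ℕ}

variable {Ω : Type*} [MeasurableSpace Ω] {P : Measure Ω} {X : Ω → Fin T → 𝒴}

lemma aemeasurable_crit (hp : IsCondDensityFamily ν Θ p) (hX : AEMeasurable X P) {β : Par d}
    (hβ : β ∈ Θ) : AEMeasurable (fun ω => crit p (X ω) β) P :=
  (measurable_crit hp hβ).comp_aemeasurable hX

lemma aemeasurable_score (hp : IsCondDensityFamily ν Θ p) (hX : AEMeasurable X P)
    (hs : ∀ᵐ ω ∂P, IsSmoothSample Θ p (X ω)) {β : Par d} (hβ : β ∈ interior Θ) :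
    AEMeasurable (fun ω => score p (X ω) β) P := by
  have h1 : AEMeasurable (fun ω => fderiv ℝ (crit p (X ω)) β) P := by
    refine aemeasurable_fderiv isOpen_interior
      (fun x hx => aemeasurable_crit hp hX (interior_subset hx)) hβ ?_
    filter_upwards [hs] with ω hω
    exact (hω.hasGradientAt hβ).differentiableAt
  exact ((InnerProductSpace.toDual ℝ (Par d)).symm.continuous.measurable).comp_aemeasurable h1

lemma aemeasurable_hess (hp : IsCondDensityFamily ν Θ p) (hX : AEMeasurable X P)
    (hs : ∀ᵐ ω ∂P, IsSmoothSample Θ p (X ω)) {β : Par d} (hβ : β ∈ interior Θ) :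
    AEMeasurable (fun ω => hess p (X ω) β) P := by
  refine aemeasurable_fderiv isOpen_interior (fun x hx => aemeasurable_score hp hX hs hx) hβ ?_
  filter_upwards [hs] with ω hω
  exact (hω.hasFDerivAt_score hβ).differentiableAt

/-- Inversion is continuous on the open set of invertible maps and is `0` by convention elsewhere.
-/
lemma measurable_clm_inverse :
    Measurable (ContinuousLinearMap.inverse : (Par d →L[ℝ] Par d) → (Par d →L[ℝ] Par d)) := by
  classical
  let S : Set (Par d →L[ℝ] Par d) := Set.range ((↑) : (Par d ≃L[ℝ] Par d) → (Par d →L[ℝ] Par d))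
  have hS : IsOpen S := ContinuousLinearEquiv.isOpen
  have h1 : ContinuousOn (ContinuousLinearMap.inverse :
      (Par d →L[ℝ] Par d) → (Par d →L[ℝ] Par d)) S := by
    rintro _ ⟨e, rfl⟩
    exact (contDiffAt_map_inverse (n := 1) e).continuousAt.continuousWithinAt
  have h2 := ContinuousOn.measurable_piecewise (g := fun _ => 0) h1 continuousOn_const
    hS.measurableSet
  convert! h2 using 1
  ext1 A
  by_cases hA : A ∈ S
  · rw [Set.piecewise_eq_of_mem _ _ _ hA]
  · rw [Set.piecewise_eq_of_notMem _ _ _ hA]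
    exact ContinuousLinearMap.inverse_of_not_isInvertible fun ⟨e, he⟩ => hA ⟨e, he⟩

lemma aemeasurable_scoreStat (hp : IsCondDensityFamily ν Θ p) (hX : AEMeasurable X P)
    (hs : ∀ᵐ ω ∂P, IsSmoothSample Θ p (X ω)) {b : Ω → Par d} (hb : AEMeasurable b P) :
    AEMeasurable (fun ω => scoreStat Θ p (X ω) (b ω)) P := by
  have : SecondCountableTopology (Par d →L[ℝ] Par d) := by
    have : ProperSpace (Par d →L[ℝ] Par d) := FiniteDimensional.proper ℝ _
    infer_instance
  have h1 : AEMeasurable (fun ω => (interior Θ).indicator (score p (X ω)) (b ω)) P := by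
    refine aemeasurable_indicator_eval isOpen_interior
      (fun x hx => aemeasurable_score hp hX hs hx) ?_ hb
    filter_upwards [hs] with ω hω
    exact hω.contDiffOn_score.continuousOn
  have h2 : AEMeasurable (fun ω => (interior Θ).indicator (hess p (X ω)) (b ω)) P := by
    refine aemeasurable_indicator_eval isOpen_interior
      (fun x hx => aemeasurable_hess hp hX hs hx) ?_ hb
    filter_upwards [hs] with ω hω
    exact hω.continuousOn_hess
  -- `φ` vanishes at the origin, so the indicators reproduce the default value `0` outside the
  -- interior.
  let φ : (Par d →L[ℝ] Par d) × Par d → ℝ := fun z =>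
    -((T : ℝ) * inner ℝ (-(z.1.inverse z.2)) (z.1 (-(z.1.inverse z.2))))
  have happ : Measurable fun z : (Par d →L[ℝ] Par d) × Par d => z.1 z.2 :=
    isBoundedBilinearMap_apply.continuous.measurable
  have hinv : Measurable fun z : (Par d →L[ℝ] Par d) × Par d => -(z.1.inverse z.2) :=
    (happ.comp ((measurable_clm_inverse.comp measurable_fst).prodMk measurable_snd)).neg
  have hφ : Measurable φ :=
    ((hinv.inner (happ.comp (measurable_fst.prodMk hinv))).const_mul _).neg
  refine (hφ.comp_aemeasurable (h2.prodMk h1)).congr (ae_of_all _ fun ω => ?_)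
  by_cases h : b ω ∈ interior Θ
  · simp [φ, scoreStat, func, Set.indicator_of_mem h]
  · simp [φ, scoreStat, Set.indicator_of_notMem h]

end Derivatives

end ScoreTest

namespace ScoreTest

/-! ### Taylor expansions of the score and of the criterion. -/

section Taylor

variable {𝒴 : Type*} {d : ℕ} {Θ : Set (Par d)}
  {p : (t : ℕ) → (Fin t → 𝒴) → 𝒴 → Par d → ℝ} {T : ℕ} {y : Fin T → 𝒴}

/-- If the Hessian is close to `-A` in a ball, then the score is almost affine there. -/
lemma IsSmoothSample.norm_score_sub_le (h : IsSmoothSample Θ p y) {β₀ : Par d} {r ε : ℝ}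
    (hr : Metric.ball β₀ r ⊆ interior Θ) {A : Par d →L[ℝ] Par d}
    (hA : ∀ β, ‖β - β₀‖ < r → ‖hess p y β + A‖ ≤ ε) {v : Par d} (hv : ‖v‖ < r) :
    ‖score p y (β₀ + v) - score p y β₀ + A v‖ ≤ ε * ‖v‖ := by
  -- Mean value inequality for the score plus `A`, whose derivative is at most `ε` in norm.
  have h1 : ∀ x ∈ Metric.ball β₀ r,
      HasFDerivWithinAt (fun x => score p y x + A x) (hess p y x + A) (Metric.ball β₀ r) x :=
    fun x hx => ((h.hasFDerivAt_score (hr hx)).add A.hasFDerivAt).hasFDerivWithinAt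
  have h2 : ∀ x ∈ Metric.ball β₀ r, ‖hess p y x + A‖ ≤ ε :=
    fun x hx => hA x (by rwa [mem_ball_iff_norm] at hx)
  have h3 := (convex_ball β₀ r).norm_image_sub_le_of_norm_hasFDerivWithin_le h1 h2
    (x := β₀) (y := β₀ + v)
    (Metric.mem_ball_self (lt_of_le_of_lt (norm_nonneg v) hv)) (by simpa using hv)
  simp only [map_add, add_sub_cancel_left] at h3
  have e : score p y (β₀ + v) - score p y β₀ + A v =
      score p y (β₀ + v) + (A β₀ + A v) - (score p y β₀ + A β₀) := by abel
  rw [e]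
  exact h3

/-- If the Hessian is close to `-A` in a ball, then the criterion is almost quadratic there. -/
lemma IsSmoothSample.abs_crit_sub_le (h : IsSmoothSample Θ p y) {β₀ : Par d} {r ε : ℝ}
    (hε : 0 ≤ ε) (hr : Metric.ball β₀ r ⊆ interior Θ) {A : Par d →L[ℝ] Par d}
    (hA : ∀ β, ‖β - β₀‖ < r → ‖hess p y β + A‖ ≤ ε) {v : Par d} (hv : ‖v‖ < r) :
    |crit p y (β₀ + v) - crit p y β₀ - inner ℝ (score p y β₀) v + inner ℝ (A v) v / 2| ≤
      ε * ‖v‖ ^ 2 := by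
  have hnorm : ∀ t ∈ Set.Icc (0 : ℝ) 1, ‖t • v‖ ≤ ‖v‖ := by
    intro t ht
    rw [norm_smul, Real.norm_of_nonneg ht.1]
    exact mul_le_of_le_one_left (norm_nonneg v) ht.2
  have hmem : ∀ t ∈ Set.Icc (0 : ℝ) 1, β₀ + t • v ∈ interior Θ := by
    intro t ht
    apply hr
    simpa using (hnorm t ht).trans_lt hv
  -- Along the segment, the derivative of the remainder is the error of the affine approximation of
  -- the score, paired with `v`.
  let k : ℝ → ℝ := fun t => crit p y (β₀ + t • v) - t * inner ℝ (score p y β₀) v +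
    t ^ 2 * (inner ℝ (A v) v / 2)
  let k' : ℝ → ℝ := fun t => inner ℝ (score p y (β₀ + t • v) - score p y β₀ + A (t • v)) v
  have hk : ∀ t ∈ Set.Icc (0 : ℝ) 1, HasDerivWithinAt k (k' t) (Set.Icc 0 1) t := by
    intro t ht
    have h1 : HasDerivAt (fun t : ℝ => β₀ + t • v) v t := by
      simpa using ((hasDerivAt_id t).smul_const v).const_add β₀
    have h2 := (h.hasGradientAt (hmem t ht)).hasFDerivAt.comp_hasDerivAt t h1
    have h3 := (h2.sub ((hasDerivAt_id t).mul_const (inner ℝ (score p y β₀) v))).add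
      ((hasDerivAt_pow 2 t).mul_const (inner ℝ (A v) v / 2))
    refine HasDerivAt.hasDerivWithinAt ?_
    convert! h3 using 1
    simp only [k', InnerProductSpace.toDual_apply_apply, inner_add_left, inner_sub_left, map_smul,
      real_inner_smul_left]
    push_cast
    ring
  have hb : ∀ t ∈ Set.Icc (0 : ℝ) 1, ‖k' t‖ ≤ ε * ‖v‖ ^ 2 := by
    intro t ht
    refine (norm_inner_le_norm _ _).trans ?_
    have h1 := h.norm_score_sub_le hr hA ((hnorm t ht).trans_lt hv)
    calc _ ≤ (ε * ‖t • v‖) * ‖v‖ := by gcongr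
      _ ≤ (ε * ‖v‖) * ‖v‖ := by gcongr; exact hnorm t ht
      _ = ε * ‖v‖ ^ 2 := by ring
  have h4 := (convex_Icc (0 : ℝ) 1).norm_image_sub_le_of_norm_hasDerivWithin_le hk hb
    (x := 0) (y := 1) (by simp) (by simp)
  simp only [k, zero_smul, one_smul, Real.norm_eq_abs, add_zero, sub_zero, abs_one, mul_one] at h4
  have e : crit p y (β₀ + v) - crit p y β₀ - inner ℝ (score p y β₀) v + inner ℝ (A v) v / 2 =
      crit p y (β₀ + v) - 1 * inner ℝ (score p y β₀) v + 1 ^ 2 * (inner ℝ (A v) v / 2) -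
        (crit p y β₀ - 0 * inner ℝ (score p y β₀) v + 0 ^ 2 * (inner ℝ (A v) v / 2)) := by ring
  rw [e]
  exact h4

/-- A second difference of the criterion, if the Hessian is close to `-A` in a ball. -/
lemma IsSmoothSample.abs_secondDifference_le (h : IsSmoothSample Θ p y) {β₀ : Par d} {r ε : ℝ}
    (hε : 0 ≤ ε) (hr : Metric.ball β₀ r ⊆ interior Θ) {A : Par d →L[ℝ] Par d}
    (hA : ∀ β, ‖β - β₀‖ < r → ‖hess p y β + A‖ ≤ ε) {v : Par d} (hv : 2 * ‖v‖ < r) :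
    |crit p y (β₀ + (2 : ℝ) • v) - 2 * crit p y (β₀ + v) + crit p y β₀ + inner ℝ (A v) v| ≤
      6 * ε * ‖v‖ ^ 2 := by
  have h2v : ‖(2 : ℝ) • v‖ = 2 * ‖v‖ := by simp [norm_smul]
  -- The linear terms cancel; the errors are `4 ε ‖v‖²` at `2v` and twice `ε ‖v‖²` at `v`, hence the
  -- constant `6`.
  have h1 := h.abs_crit_sub_le hε hr hA (v := v) (by linarith [norm_nonneg v])
  have h2 := h.abs_crit_sub_le hε hr hA (v := (2 : ℝ) • v) (by rwa [h2v])
  simp only [h2v, map_smul, real_inner_smul_left, real_inner_smul_right] at h2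
  rw [abs_le] at h1 h2 ⊢
  constructor <;> nlinarith

/-- The log-likelihood ratio of the local parameter `h` to `0`. -/
noncomputable def localLogRatio (p : (t : ℕ) → (Fin t → 𝒴) → 𝒴 → Par d → ℝ) {T : ℕ}
    (y : Fin T → 𝒴) (β₀ h : Par d) : ℝ :=
  T * (crit p y (β₀ + (√(T : ℝ))⁻¹ • h) - crit p y β₀)

lemma mul_norm_inv_sqrt_smul_sq (hT : 0 < T) (h : Par d) :
    (T : ℝ) * ‖(√(T : ℝ))⁻¹ • h‖ ^ 2 = ‖h‖ ^ 2 := by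
  have hT' : (0 : ℝ) < T := by exact_mod_cast hT
  rw [norm_smul, mul_pow, norm_inv, inv_pow, Real.norm_of_nonneg (Real.sqrt_nonneg _),
    Real.sq_sqrt hT'.le]
  field_simp

/-- Local asymptotic quadraticity. -/
lemma IsSmoothSample.abs_localLogRatio_sub_le (hs : IsSmoothSample Θ p y) (hT : 0 < T)
    {β₀ : Par d} {r ε : ℝ}
    (hε : 0 ≤ ε) (hr : Metric.ball β₀ r ⊆ interior Θ) {A : Par d →L[ℝ] Par d}
    (hA : ∀ β, ‖β - β₀‖ < r → ‖hess p y β + A‖ ≤ ε) {h : Par d}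
    (hh : ‖(√(T : ℝ))⁻¹ • h‖ < r) :
    |localLogRatio p y β₀ h - (inner ℝ (√(T : ℝ) • score p y β₀) h - inner ℝ (A h) h / 2)| ≤
      ε * ‖h‖ ^ 2 := by
  have hT' : (0 : ℝ) < T := by exact_mod_cast hT
  have h1 := hs.abs_crit_sub_le hε hr hA hh
  have h2 := mul_le_mul_of_nonneg_left h1 hT'.le
  have hsq : (T : ℝ) * (√(T : ℝ))⁻¹ = √(T : ℝ) := by
    rw [mul_inv_eq_iff_eq_mul₀ (by positivity), Real.mul_self_sqrt hT'.le]
  have hsq2 : (T : ℝ) * ((√(T : ℝ))⁻¹ * (√(T : ℝ))⁻¹) = 1 := by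
    rw [← mul_assoc, hsq, mul_inv_cancel₀ (by positivity)]
  rw [← abs_of_pos hT', ← abs_mul, abs_of_pos hT', mul_left_comm,
    mul_norm_inv_sqrt_smul_sq hT] at h2
  refine le_trans (le_of_eq (congrArg abs ?_)) h2
  simp only [localLogRatio, map_smul, real_inner_smul_left, real_inner_smul_right]
  linear_combination inner ℝ (score p y β₀) h * hsq - inner ℝ (A h) h / 2 * hsq2

end Taylor

/-! ### Local quadraticity of the observed likelihood, the pseudo-true value and the limit of the
score. -/

section Observed

variable {𝒴 : Type*} [MeasurableSpace 𝒴] {d q : ℕ} {ν : Measure 𝒴} {Θ : Set (Par d)}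
  {p : (t : ℕ) → (Fin t → 𝒴) → 𝒴 → Par d → ℝ}
  {Ω : Type*} [MeasurableSpace Ω] {P : Measure Ω} [IsProbabilityMeasure P]
  {Y : ℕ → Ω → 𝒴} {β₀ L₀ : Par d} {I₀ J₀ : Matrix (Fin d) (Fin d) ℝ}

lemma eventually_ball_subset_interior (hβ₀ : β₀ ∈ interior Θ) {r : ℕ → ℝ}
    (hr : Tendsto r atTop (𝓝 0)) : ∀ᶠ T in atTop, Metric.ball β₀ (r T) ⊆ interior Θ := by
  obtain ⟨ε, hε, h⟩ := Metric.isOpen_iff.1 isOpen_interior β₀ hβ₀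
  filter_upwards [hr.eventually_lt_const hε] with T hT
  exact (Metric.ball_subset_ball hT.le).trans h

lemma tendsto_inv_sqrt_natCast : Tendsto (fun T : ℕ => (√(T : ℝ))⁻¹) atTop (𝓝 0) :=
  tendsto_inv_atTop_zero.comp (Real.tendsto_sqrt_atTop.comp tendsto_natCast_atTop_atTop)

/-- The Hessian of the observed criterion converges uniformly on shrinking balls. -/
lemma ObservedRegularity.hess_unif (hobs : ObservedRegularity P Θ p Y β₀ L₀ I₀ J₀)
    (hp : IsCondDensityFamily ν Θ p) (hY : ∀ T, AEMeasurable (sample Y T) P)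
    (hβ₀ : β₀ ∈ interior Θ) {r : ℕ → ℝ} (hr0 : ∀ᶠ T in atTop, 0 < r T)
    (hr : Tendsto r atTop (𝓝 0)) {ε : ℝ} (hε : 0 < ε) :
    WithHighProb P fun T ω =>
      ∀ β, ‖β - β₀‖ < r T → ‖hess p (sample Y T ω) β + matMap J₀‖ ≤ ε := by
  -- The assumption speaks of single consistent random sequences. A measurable choice of a violating
  -- point in each ball gives such a sequence and so makes the bound uniform; for the finitely many
  -- degenerate balls any interior point will do.
  have hchoice : ∀ T, ∃ b : Ω → Par d, Measurable b ∧ (∀ ω, b ω ∈ interior Θ) ∧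
      ((0 < r T ∧ Metric.ball β₀ (r T) ⊆ interior Θ) → (∀ ω, ‖b ω - β₀‖ < r T) ∧
        ∀ᵐ ω ∂P, (∃ β ∈ Metric.ball β₀ (r T), ε < ‖hess p (sample Y T ω) β + matMap J₀‖) →
          ε < ‖hess p (sample Y T ω) (b ω) + matMap J₀‖) := by
    intro T
    by_cases hT : 0 < r T ∧ Metric.ball β₀ (r T) ⊆ interior Θ
    · obtain ⟨b, hb, hbS, hbe⟩ := exists_measurable_point_of_exceed (P := P)
        (f := fun ω β => ‖hess p (sample Y T ω) β + matMap J₀‖) (Metric.nonempty_ball.2 hT.1)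
        (fun x hx => ((aemeasurable_hess hp (hY T) (hobs.smooth T) (hT.2 hx)).add_const _).norm)
        (by
          filter_upwards [hobs.smooth T] with ω hω
          exact ((hω.continuousOn_hess.mono hT.2).add continuousOn_const).norm) ε
      exact ⟨b, hb, fun ω => hT.2 (hbS ω), fun _ =>
        ⟨fun ω => mem_ball_iff_norm.1 (hbS ω), hbe⟩⟩
    · exact ⟨fun _ => β₀, measurable_const, fun _ => hβ₀, fun h => absurd h hT⟩
  choose b hbm hbU hb using hchoice
  have hgood : ∀ᶠ T in atTop, 0 < r T ∧ Metric.ball β₀ (r T) ⊆ interior Θ :=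
    hr0.and (eventually_ball_subset_interior hβ₀ hr)
  have hbl : TendstoInMeasure P b atTop fun _ => β₀ := by
    rw [tendstoInMeasure_iff_withHighProb]
    intro δ hδ
    refine WithHighProb.of_eventually_ae ?_
    filter_upwards [hgood, hr.eventually_lt_const hδ] with T hT hT'
    exact ae_of_all _ fun ω => ((hb T hT).1 ω).trans hT'
  have hlim := (tendstoInMeasure_iff_withHighProb.1
    (hobs.hess_lim b (fun T => (hbm T).aemeasurable) hbU hbl)) ε hε
  refine hlim.mono ?_
  filter_upwards [hgood] with T hT
  filter_upwards [(hb T hT).2] with ω hω h1 β hβ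
  by_contra hcon
  have h2 := hω ⟨β, mem_ball_iff_norm.2 hβ, not_le.1 hcon⟩
  rw [sub_neg_eq_add] at h1
  exact absurd h1 (not_lt.2 h2.le)

/-- The log-likelihood ratio at a local parameter is quadratic in the limit. -/
lemma ObservedRegularity.localLogRatio_lim (hobs : ObservedRegularity P Θ p Y β₀ L₀ I₀ J₀)
    (hp : IsCondDensityFamily ν Θ p) (hY : ∀ T, AEMeasurable (sample Y T) P)
    (hβ₀ : β₀ ∈ interior Θ) (h : Par d) {ε : ℝ} (hε : 0 < ε) :
    WithHighProb P fun T ω =>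
      |localLogRatio p (sample Y T ω) β₀ h - (inner ℝ (√(T : ℝ) • score p (sample Y T ω) β₀) h -
        inner ℝ (matMap J₀ h) h / 2)| < ε := by
  let r : ℕ → ℝ := fun T => (√(T : ℝ))⁻¹ * (‖h‖ + 1)
  have hr0 : ∀ᶠ T in atTop, 0 < r T := by
    filter_upwards [eventually_gt_atTop 0] with T hT
    have : (0 : ℝ) < T := by exact_mod_cast hT
    positivity
  have hr : Tendsto r atTop (𝓝 0) := by
    simpa using tendsto_inv_sqrt_natCast.mul_const (‖h‖ + 1)
  have hε' : 0 < ε / (‖h‖ ^ 2 + 1) := by positivity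
  refine (hobs.hess_unif hp hY hβ₀ hr0 hr hε').mono ?_
  filter_upwards [eventually_gt_atTop 0, eventually_ball_subset_interior hβ₀ hr] with T hT hT'
  have hT0 : (0 : ℝ) < T := by exact_mod_cast hT
  filter_upwards [hobs.smooth T] with ω hω h1
  refine (hω.abs_localLogRatio_sub_le hT hε'.le hT' h1 ?_).trans_lt ?_
  · rw [norm_smul, norm_inv, Real.norm_of_nonneg (Real.sqrt_nonneg _)]
    have : 0 < (√(T : ℝ))⁻¹ := by positivity
    simp only [r]
    nlinarith
  · rw [div_mul_eq_mul_div, div_lt_iff₀ (by positivity)]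
    nlinarith

/-- The pseudo-true value is the true value under the null hypothesis. -/
lemma IsPseudoTrue.eq_of_null {g : Par d → EuclideanSpace ℝ (Fin q)}
    (hβ₀ : IsPseudoTrue P Θ p g Y β₀) (hp : IsCondDensityFamily ν Θ p) {θ₀ : Par d}
    (hθ₀ : θ₀ ∈ interior Θ) (hnull : g θ₀ = 0)
    (hY : ∀ T, HasLaw (sample Y T) (sampleLaw ν p T θ₀) P)
    (hmass : ∀ θ ∈ Θ, ∀ T, sampleLaw ν p T θ Set.univ ≤ 1)
    (hs : ∀ T, ∀ᵐ ω ∂P, IsSmoothSample Θ p (sample Y T ω)) : θ₀ = β₀ := by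
  by_contra hne
  obtain ⟨hβint, -, hmax⟩ := hβ₀
  obtain ⟨δ, hδ, hlim⟩ := hmax θ₀ hθ₀ hnull hne
  have h1 : WithHighProb P fun T ω =>
      ¬ crit p (sample Y T ω) β₀ < crit p (sample Y T ω) θ₀ + δ := by
    simpa [WithHighProb, not_not] using hlim
  -- The ratio of `β₀` to the true value exceeds `exp (T δ)` with probability at most `exp (-T δ)`,
  -- whereas pseudo-truth demands it with probability tending to one.
  have h2 : WithHighProb P fun T ω =>
      ¬ (T * δ ≤ T * (crit p (sample Y T ω) β₀ - crit p (sample Y T ω) θ₀)) := by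
    have hexp : Tendsto (fun T : ℕ => ENNReal.ofReal (Real.exp (-(T * δ)))) atTop (𝓝 0) := by
      rw [← ENNReal.ofReal_zero]
      refine (ENNReal.continuous_ofReal.tendsto _).comp
        (Real.tendsto_exp_neg_atTop_nhds_zero.comp ?_)
      exact tendsto_natCast_atTop_atTop.atTop_mul_const hδ
    refine tendsto_of_tendsto_of_tendsto_of_le_of_le tendsto_const_nhds hexp
      (fun _ => zero_le) fun T => ?_
    simp only [not_not]
    refine measure_le_logRatio_le hp (interior_subset hθ₀) (interior_subset hβint) (hY T)
      (hmass _ (interior_subset hβint) T) ?_ ?_ _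
    · filter_upwards [hs T] with ω hω
      exact hω.1 _ hθ₀
    · filter_upwards [hs T] with ω hω
      exact hω.1 _ hβint
  obtain ⟨T, ω, h3, h4⟩ := ((h1.and h2).eventually_exists).exists
  apply h4
  have : (0 : ℝ) ≤ T := Nat.cast_nonneg T
  push Not at h3
  exact mul_le_mul_of_nonneg_left (by linarith) this

/-- The limit of the score at the true value vanishes. -/
lemma ObservedRegularity.limit_eq_zero (hobs : ObservedRegularity P Θ p Y β₀ L₀ I₀ J₀)
    (hp : IsCondDensityFamily ν Θ p) (hβ₀ : β₀ ∈ interior Θ)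
    (hY : ∀ T, HasLaw (sample Y T) (sampleLaw ν p T β₀) P)
    (hmass : ∀ θ ∈ Θ, ∀ T, sampleLaw ν p T θ Set.univ ≤ 1) : L₀ = 0 := by
  by_contra hne
  have hL : 0 < ‖L₀‖ := norm_pos_iff.2 hne
  obtain ⟨M, hM⟩ := BoundedInProb.of_tendstoInDistribution hobs.score_clt (4⁻¹) (by norm_num)
  have hquad := ENNReal.tendsto_nhds_zero.1
    (hobs.localLogRatio_lim hp (fun T => (hY T).aemeasurable) hβ₀ L₀ one_pos) 4⁻¹ (by norm_num)
  have hr : Tendsto (fun T : ℕ => (√(T : ℝ))⁻¹ * (‖L₀‖ + 1)) atTop (𝓝 0) := by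
    simpa using tendsto_inv_sqrt_natCast.mul_const (‖L₀‖ + 1)
  have hbig : Tendsto (fun T : ℕ => √(T : ℝ) * ‖L₀‖ ^ 2) atTop atTop :=
    (Real.tendsto_sqrt_atTop.comp tendsto_natCast_atTop_atTop).atTop_mul_const (by positivity)
  -- At the local parameter `L₀` the log-ratio is `√T ‖L₀‖²` plus a bounded term. The threshold
  -- makes it at least `1` off two events of probability at most `1/4` each, while Markov's
  -- inequality allows this only with probability at most `exp (-1) < 1/2`.
  obtain ⟨T, h1, h2, h3, h4, hT⟩ := (hM.and (hquad.and
    ((eventually_ball_subset_interior hβ₀ hr).and ((hbig.eventually_ge_atTop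
      (2 + M * ‖L₀‖ + inner ℝ (matMap J₀ L₀) L₀ / 2)).and (eventually_gt_atTop 0))))).exists
  have hT0 : (0 : ℝ) < T := by exact_mod_cast hT
  have hmem : β₀ + (√(T : ℝ))⁻¹ • L₀ ∈ interior Θ := by
    apply h3
    have : 0 < (√(T : ℝ))⁻¹ := by positivity
    simp only [Metric.mem_ball, dist_self_add_left, norm_smul, norm_inv,
      Real.norm_of_nonneg (Real.sqrt_nonneg _)]
    nlinarith
  have h5 := measure_le_logRatio_le hp (interior_subset hβ₀) (interior_subset hmem) (hY T)
    (hmass _ (interior_subset hmem) T)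
    (by filter_upwards [hobs.smooth T] with ω hω using hω.1 _ hβ₀)
    (by filter_upwards [hobs.smooth T] with ω hω using hω.1 _ hmem) 1
  have h6 : ENNReal.ofReal (Real.exp (-1)) < 2⁻¹ := by
    have : Real.exp (-1) < 2⁻¹ := by
      rw [Real.exp_neg]
      exact inv_strictAnti₀ (by norm_num) (by linarith [Real.exp_one_gt_d9])
    rw [show (2⁻¹ : ENNReal) = ENNReal.ofReal 2⁻¹ by
      rw [ENNReal.ofReal_inv_of_pos (by norm_num)]; simp]
    exact (ENNReal.ofReal_lt_ofReal_iff (by norm_num)).2 this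
  have hcover : (Set.univ : Set Ω) ⊆
      ({ω | M < ‖√(T : ℝ) • (score p (sample Y T ω) β₀ - L₀)‖} ∪
      {ω | ¬ |localLogRatio p (sample Y T ω) β₀ L₀ -
        (inner ℝ (√(T : ℝ) • score p (sample Y T ω) β₀) L₀ -
        inner ℝ (matMap J₀ L₀) L₀ / 2)| < 1}) ∪
      {ω | 1 ≤ T * (crit p (sample Y T ω) (β₀ + (√(T : ℝ))⁻¹ • L₀) -
        crit p (sample Y T ω) β₀)} := by
    intro ω _
    by_contra hcon
    simp only [Set.mem_union, Set.mem_ofPred_eq, not_or, not_lt] at hcon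
    obtain ⟨⟨h7, h8⟩, h9⟩ := hcon
    apply h9
    have h10 : √(T : ℝ) • score p (sample Y T ω) β₀ =
        √(T : ℝ) • (score p (sample Y T ω) β₀ - L₀) + √(T : ℝ) • L₀ := by
      rw [← smul_add, sub_add_cancel]
    rw [h10, inner_add_left, real_inner_smul_left L₀ L₀, real_inner_self_eq_norm_sq] at h8
    have h11 : -(M * ‖L₀‖) ≤ inner ℝ (√(T : ℝ) • (score p (sample Y T ω) β₀ - L₀)) L₀ := by
      have := (abs_le.1 (abs_real_inner_le_norm
        (√(T : ℝ) • (score p (sample Y T ω) β₀ - L₀)) L₀)).1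
      have := mul_le_mul_of_nonneg_right h7 hL.le
      linarith
    have h12 := (abs_lt.1 (not_le.1 h8)).1
    simp only [localLogRatio] at h12
    linarith
  have h7 := (measure_mono (μ := P) hcover).trans ((measure_union_le _ _).trans
    (add_le_add_left (measure_union_le _ _) _))
  rw [measure_univ] at h7
  have h8 : (1 : ENNReal) < 4⁻¹ + 4⁻¹ + 2⁻¹ := by
    refine h7.trans_lt (ENNReal.add_lt_add_of_le_of_lt ?_ (add_le_add h1 h2) (h5.trans_lt h6))
    exact ne_top_of_le_ne_top (by simp) (add_le_add h1 h2)
  have h9 : (4⁻¹ + 4⁻¹ + 2⁻¹ : ENNReal) = 1 := by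
    have : (4⁻¹ : ENNReal) = 2⁻¹ / 2 := by
      rw [ENNReal.div_eq_inv_mul, ← ENNReal.mul_inv] <;> norm_num
    rw [this, ENNReal.add_halves, ENNReal.inv_two_add_inv_two]
  exact absurd h9.symm h8.ne

end Observed

end ScoreTest

namespace ScoreTest

/-! ### Likelihood ratios under local alternatives. -/

section Simulated

variable {𝒴 : Type*} {d : ℕ} {Θ : Set (Par d)}
  {p : (t : ℕ) → (Fin t → 𝒴) → 𝒴 → Par d → ℝ}
  {Ω : Type*} [MeasurableSpace Ω] {P : Measure Ω}
  {Ysim : Par d → ℕ → Ω → 𝒴} {β₀ : Par d} {L : Par d → Par d}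
  {J : Par d → Matrix (Fin d) (Fin d) ℝ}

/-- The second difference of the local log-likelihood ratio is bounded under the law of the
parameter `θ`, uniformly in `θ`, up to the value of the quadratic form of `J θ`. -/
lemma SimulatedLimits.secondDifference (hlim : SimulatedLimits P Θ p Ysim β₀ L J)
    (hs : ∀ θ ∈ Θ, ∀ T, ∀ᵐ ω ∂P, IsSmoothSample Θ p (sample (Ysim θ) T ω))
    (hβ₀ : β₀ ∈ interior Θ) (h : Par d) {η : ENNReal} (hη : 0 < η) :
    ∀ᶠ T in atTop, ∀ θ ∈ Θ, P {ω | ¬ |localLogRatio p (sample (Ysim θ) T ω) β₀ ((2 : ℝ) • h) -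
      2 * localLogRatio p (sample (Ysim θ) T ω) β₀ h + inner ℝ (matMap (J θ) h) h| ≤
        6 * ‖h‖ ^ 2} ≤ η := by
  -- The ball must contain both local parameters `h` and `2h` with strict room.
  have hγ : 0 < 2 * ‖h‖ + 1 := by positivity
  have hr : Tendsto (fun T : ℕ => (2 * ‖h‖ + 1) / √(T : ℝ)) atTop (𝓝 0) := by
    simpa [div_eq_mul_inv] using tendsto_inv_sqrt_natCast.const_mul (2 * ‖h‖ + 1)
  filter_upwards [ENNReal.tendsto_nhds_zero.1 (hlim.hess_lim _ hγ 1 one_pos) η hη,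
    eventually_ball_subset_interior hβ₀ hr, eventually_gt_atTop 0] with T h1 h2 hT θ hθ
  have hT0 : (0 : ℝ) < T := by exact_mod_cast hT
  refine le_trans (measure_mono_ae ?_) h1
  filter_upwards [hs θ hθ T] with ω hω h3
  by_contra h4
  apply h3
  have h5 : ∀ β, ‖β - β₀‖ < (2 * ‖h‖ + 1) / √(T : ℝ) →
      ‖hess p (sample (Ysim θ) T ω) β + matMap (J θ)‖ ≤ 1 := by
    intro β hβ
    by_contra h6
    exact h4 ⟨θ, hθ, β, hβ.le, not_le.1 h6⟩
  have hv : 2 * ‖(√(T : ℝ))⁻¹ • h‖ < (2 * ‖h‖ + 1) / √(T : ℝ) := by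
    rw [norm_smul, norm_inv, Real.norm_of_nonneg (Real.sqrt_nonneg _), div_eq_inv_mul]
    have : 0 < (√(T : ℝ))⁻¹ := by positivity
    nlinarith
  have h7 := mul_le_mul_of_nonneg_left (hω.abs_secondDifference_le zero_le_one h2 h5 hv) hT0.le
  have hsq2 : (T : ℝ) * ((√(T : ℝ))⁻¹ * (√(T : ℝ))⁻¹) = 1 := by
    rw [← mul_inv, Real.mul_self_sqrt hT0.le, mul_inv_cancel₀ hT0.ne']
  rw [← abs_of_pos hT0, ← abs_mul, abs_of_pos hT0, mul_one, mul_left_comm,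
    mul_norm_inv_sqrt_smul_sq hT] at h7
  refine le_trans (le_of_eq (congrArg abs ?_)) h7
  simp only [localLogRatio, map_smul, real_inner_smul_left, real_inner_smul_right,
    smul_comm (√(T : ℝ))⁻¹ (2 : ℝ) h]
  linear_combination -inner ℝ (matMap (J θ) h) h * hsq2

variable [MeasurableSpace 𝒴] {ν : Measure 𝒴} [IsProbabilityMeasure P]

/-- The limit of the simulated Hessian is locally bounded at the parameter `β₀`, along every
sequence. -/
lemma SimulatedLimits.exists_bound (hlim : SimulatedLimits P Θ p Ysim β₀ L J)
    (hs : ∀ θ ∈ Θ, ∀ T, ∀ᵐ ω ∂P, IsSmoothSample Θ p (sample (Ysim θ) T ω))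
    (hp : IsCondDensityFamily ν Θ p) (hβ₀ : β₀ ∈ interior Θ)
    (hYsim : ∀ θ ∈ Θ, ∀ T, HasLaw (sample (Ysim θ) T) (sampleLaw ν p T θ) P)
    {u : ℕ → Par d} (hu : ∀ n, u n ∈ Θ) (hulim : Tendsto u atTop (𝓝 β₀)) (h : Par d) :
    ∃ K : ℝ, ∀ᶠ n in atTop, inner ℝ (matMap (J (u n)) h) h ≤ K := by
  have hr : Tendsto (fun T : ℕ => (√(T : ℝ))⁻¹ * (2 * ‖h‖ + 1)) atTop (𝓝 0) := by
    simpa using tendsto_inv_sqrt_natCast.mul_const (2 * ‖h‖ + 1)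
  -- The sample size is frozen from here on; only the parameter `u n` moves. This works because the
  -- second-difference bound is uniform in the parameter.
  obtain ⟨T, h1, h2, hT⟩ := ((hlim.secondDifference hs hβ₀ h (η := 4⁻¹) (by norm_num)).and
    ((eventually_ball_subset_interior hβ₀ hr).and (eventually_gt_atTop 0))).exists
  have hT0 : (0 : ℝ) < T := by exact_mod_cast hT
  have hpos : 0 < (√(T : ℝ))⁻¹ := by positivity
  have hmem : ∀ c : ℝ, |c| ≤ 2 → β₀ + (√(T : ℝ))⁻¹ • (c • h) ∈ Θ := by
    intro c hc
    apply interior_subset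
    apply h2
    simp only [Metric.mem_ball, dist_self_add_left, norm_smul, norm_inv,
      Real.norm_of_nonneg (Real.sqrt_nonneg _), Real.norm_eq_abs]
    have := mul_le_mul_of_nonneg_right hc (norm_nonneg h)
    nlinarith
  let D : (Fin T → 𝒴) → ℝ := fun y =>
    localLogRatio p y β₀ ((2 : ℝ) • h) - 2 * localLogRatio p y β₀ h
  have hΛ : ∀ c : ℝ, |c| ≤ 2 → Measurable fun y : Fin T → 𝒴 => localLogRatio p y β₀ (c • h) :=
    fun c hc => ((measurable_crit hp (hmem c hc)).sub
      (measurable_crit hp (interior_subset hβ₀))).const_mul _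
  have hD : Measurable D := by
    refine (hΛ 2 (by norm_num)).sub (Measurable.const_mul ?_ 2)
    simpa using hΛ 1 (by norm_num)
  let A : ℕ → Set (Fin T → 𝒴) := fun k => {y | |D y| ≤ k}
  have hA : ∀ k, MeasurableSet (A k) := fun k =>
    measurableSet_le (measurable_abs.comp hD) measurable_const
  have hβΘ := interior_subset hβ₀
  have hprob : ∀ θ ∈ Θ, IsProbabilityMeasure (sampleLaw ν p T θ) := fun θ hθ =>
    (hYsim θ hθ T).isProbabilityMeasure_iff.1 inferInstance
  obtain ⟨k, hk⟩ : ∃ k, (2⁻¹ : ENNReal) < sampleLaw ν p T β₀ (A k) := by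
    have hmono : Monotone A := by
      intro m n hmn y hy
      simp only [A, Set.mem_ofPred_eq] at hy ⊢
      exact hy.trans (Nat.cast_le.2 hmn)
    have hlimA := tendsto_measure_iUnion_atTop (μ := sampleLaw ν p T β₀) hmono
    have huniv : ⋃ k, A k = Set.univ := by
      refine Set.eq_univ_of_forall fun y => ?_
      obtain ⟨n, hn⟩ := exists_nat_ge |D y|
      exact Set.mem_iUnion.2 ⟨n, hn⟩
    have := hprob β₀ hβΘ
    rw [huniv, measure_univ] at hlimA
    exact (hlimA.eventually_const_lt (by simp)).exists
  have hlsc := sampleLaw_le_liminf hp hβΘ hu (hYsim β₀ hβΘ T) (by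
    filter_upwards [hs β₀ hβΘ T] with ω hω
    exact hω.tendsto_pathDensity hβ₀ hulim) (hA k)
  refine ⟨k + 6 * ‖h‖ ^ 2, ?_⟩
  filter_upwards [eventually_lt_of_lt_liminf (hk.trans_le hlsc)] with n hn
  have h3 : P {ω | ¬ |D (sample (Ysim (u n)) T ω) + inner ℝ (matMap (J (u n)) h) h| ≤
      6 * ‖h‖ ^ 2} < P (sample (Ysim (u n)) T ⁻¹' A k) := by
    refine (h1 (u n) (hu n)).trans_lt (lt_of_le_of_lt ?_ (hn.trans_eq ?_))
    · exact ENNReal.inv_le_inv.2 (by norm_num)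
    · rw [← (hYsim (u n) (hu n) T).map_eq,
        Measure.map_apply_of_aemeasurable (hYsim (u n) (hu n) T).aemeasurable (hA k)]
  -- Under `u n`, `|D| ≤ k` has probability above `1/2` and the second-difference bound fails with
  -- probability at most `1/4`. A common outcome bounds the deterministic quadratic form.
  obtain ⟨ω, hω1, hω2⟩ : ∃ ω, |D (sample (Ysim (u n)) T ω)| ≤ k ∧
      |D (sample (Ysim (u n)) T ω) + inner ℝ (matMap (J (u n)) h) h| ≤ 6 * ‖h‖ ^ 2 := by
    by_contra hcon
    push Not at hcon
    refine absurd (measure_mono (μ := P) fun ω hω => ?_) (not_le.2 h3)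
    exact not_le.2 (hcon ω hω)
  have h4 := (abs_le.1 hω1).1
  have h5 := (abs_le.1 hω2).2
  linarith

/-- The log-likelihood ratio is bounded above in probability under the local alternatives. -/
lemma SimulatedLimits.localLogRatio_tight (hlim : SimulatedLimits P Θ p Ysim β₀ L J)
    (hs : ∀ θ ∈ Θ, ∀ T, ∀ᵐ ω ∂P, IsSmoothSample Θ p (sample (Ysim θ) T ω))
    (hp : IsCondDensityFamily ν Θ p) (hβ₀ : β₀ ∈ interior Θ)
    (hYsim : ∀ θ ∈ Θ, ∀ T, HasLaw (sample (Ysim θ) T) (sampleLaw ν p T θ) P)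
    (h : Par d) {η : ENNReal} (hη : 0 < η) :
    ∃ m : ℝ, ∀ᶠ T : ℕ in atTop, P {ω | ¬ localLogRatio p
      (sample (Ysim (β₀ + (√(T : ℝ))⁻¹ • h)) T ω) β₀ h ≤ m} ≤ η := by
  have hr : ∀ h : Par d, ∀ᶠ T : ℕ in atTop, β₀ + (√(T : ℝ))⁻¹ • h ∈ interior Θ := by
    intro h
    have : Tendsto (fun T : ℕ => β₀ + (√(T : ℝ))⁻¹ • h) atTop (𝓝 (β₀ + (0 : ℝ) • h)) :=
      tendsto_const_nhds.add (tendsto_inv_sqrt_natCast.smul_const h)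
    rw [zero_smul, add_zero] at this
    exact this.eventually (isOpen_interior.mem_nhds hβ₀)
  obtain ⟨N, hN⟩ := eventually_atTop.1 (hr h)
  obtain ⟨K, hK⟩ := hlim.exists_bound hs hp hβ₀ hYsim
    (u := fun n : ℕ => β₀ + (√((n + N : ℕ) : ℝ))⁻¹ • h)
    (fun n => interior_subset (hN _ (Nat.le_add_left _ _))) (by
      have : Tendsto (fun T : ℕ => β₀ + (√(T : ℝ))⁻¹ • h) atTop (𝓝 (β₀ + (0 : ℝ) • h)) :=
        tendsto_const_nhds.add (tendsto_inv_sqrt_natCast.smul_const h)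
      rw [zero_smul, add_zero] at this
      exact this.comp (tendsto_add_atTop_nat N)) h
  have hK' : ∀ᶠ T : ℕ in atTop, inner ℝ (matMap (J (β₀ + (√(T : ℝ))⁻¹ • h)) h) h ≤ K := by
    obtain ⟨N', hN'⟩ := eventually_atTop.1 hK
    filter_upwards [eventually_ge_atTop (N' + N)] with T hT
    have := hN' (T - N) (by omega)
    rwa [Nat.sub_add_cancel (by omega)] at this
  have hη2 : 0 < η / 2 := ENNReal.half_pos hη.ne'
  obtain ⟨c, hc⟩ : ∃ c : ℝ, ENNReal.ofReal (Real.exp (-c)) ≤ η / 2 := by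
    have : Tendsto (fun c : ℝ => ENNReal.ofReal (Real.exp (-c))) atTop (𝓝 0) := by
      rw [← ENNReal.ofReal_zero]
      exact (ENNReal.continuous_ofReal.tendsto _).comp Real.tendsto_exp_neg_atTop_nhds_zero
    exact (ENNReal.tendsto_nhds_zero.1 this _ hη2).exists
  -- With `Λ` the local log-ratio, `Λ(h) = [Λ(2h) - Λ(h)] - [Λ(2h) - 2 Λ(h)]`. Under the law of `h`,
  -- the first bracket is below `c` by Markov's inequality and the second is at least `-K - 6 ‖h‖²`.
  refine ⟨c + K + 6 * ‖h‖ ^ 2, ?_⟩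
  filter_upwards [hlim.secondDifference hs hβ₀ h hη2, hK', hr h, hr ((2 : ℝ) • h)]
    with T h1 h2 h3 h4
  set θ := β₀ + (√(T : ℝ))⁻¹ • h with hθ
  set θ' := β₀ + (√(T : ℝ))⁻¹ • ((2 : ℝ) • h) with hθ'
  have h3' := interior_subset h3
  have h4' := interior_subset h4
  have := (hYsim θ' h4' T).isProbabilityMeasure_iff.1 inferInstance
  have h5 := measure_le_logRatio_le hp h3' h4' (hYsim θ h3' T) measure_univ.le
    (by filter_upwards [hs θ h3' T] with ω hω using hω.1 _ h3)
    (by filter_upwards [hs θ h3' T] with ω hω using hω.1 _ h4) c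
  rw [← ENNReal.add_halves η]
  refine le_trans (measure_mono ?_) ((measure_union_le _ _).trans
    (add_le_add (h1 θ h3') (h5.trans hc)))
  intro ω hω
  simp only [Set.mem_ofPred_eq, Set.mem_union] at hω ⊢
  by_contra hcon
  push Not at hcon
  obtain ⟨h6, h7⟩ := hcon
  have h8 := (abs_le.1 h6).1
  apply hω
  simp only [localLogRatio, ← hθ, ← hθ'] at h8 ⊢
  linarith

end Simulated

/-! ### The information equality. -/

section InformationEquality

/-- The marginals of a centered multivariate Gaussian law. -/
lemma map_inner_multivariateGaussian {d : ℕ} {S : Matrix (Fin d) (Fin d) ℝ} (hS : S.PosSemidef)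
    (h : Par d) : (multivariateGaussian 0 S).map (fun z => inner ℝ h z) =
      gaussianReal 0 (inner ℝ h (matMap S h)).toNNReal := by
  have h1 := IsGaussian.map_eq_gaussianReal (μ := multivariateGaussian 0 S) (innerSL ℝ h)
  have h2 : ∫ z, (innerSL ℝ h) z ∂(multivariateGaussian 0 S) = 0 := by
    rw [ContinuousLinearMap.integral_comp_id_comm IsGaussian.integrable_id,
      integral_id_multivariateGaussian, map_zero]
  have h3 : Var[innerSL ℝ h; multivariateGaussian 0 S] = inner ℝ h (matMap S h) := by
    rw [Matrix.inner_toEuclideanCLM, ← covarianceBilin_multivariateGaussian (μ := 0) hS,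
      covarianceBilin_self IsGaussian.memLp_two_id]
    rfl
  rw [h2, h3] at h1
  exact h1

/-- The exponential moment of an affine function of a centered multivariate Gaussian vector. -/
lemma lintegral_exp_inner_multivariateGaussian {d : ℕ} {S : Matrix (Fin d) (Fin d) ℝ}
    (hS : S.PosSemidef) (h : Par d) (c : ℝ) :
    ∫⁻ z, ENNReal.ofReal (Real.exp (inner ℝ h z - c)) ∂(multivariateGaussian 0 S) =
      ENNReal.ofReal (Real.exp (inner ℝ h (matMap S h) / 2 - c)) := by
  have hv : 0 ≤ inner ℝ h (matMap S h) := by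
    rw [Matrix.inner_toEuclideanCLM]
    simpa using hS.dotProduct_mulVec_nonneg h.ofLp
  have h1 : ∫⁻ z, ENNReal.ofReal (Real.exp (inner ℝ h z - c)) ∂(multivariateGaussian 0 S) =
      ∫⁻ x, ENNReal.ofReal (Real.exp (x - c))
        ∂(gaussianReal 0 (inner ℝ h (matMap S h)).toNNReal) := by
    rw [← map_inner_multivariateGaussian hS h]
    exact (lintegral_map (f := fun x => ENNReal.ofReal (Real.exp (x - c)))
      (g := fun z : Par d => inner ℝ h z) (by fun_prop) (by fun_prop)).symm
  have hint : Integrable (fun x => Real.exp (x - c))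
      (gaussianReal 0 (inner ℝ h (matMap S h)).toNNReal) := by
    have := (integrable_exp_mul_gaussianReal (μ := 0)
      (v := (inner ℝ h (matMap S h)).toNNReal) 1).mul_const (Real.exp (-c))
    simpa [sub_eq_add_neg, Real.exp_add] using this
  rw [h1, ← ofReal_integral_eq_lintegral_ofReal hint (ae_of_all _ fun _ => (Real.exp_pos _).le)]
  congr 1
  have h2 := congrFun (mgf_id_gaussianReal (μ := 0) (v := (inner ℝ h (matMap S h)).toNNReal)) 1
  simp only [mgf, id, one_mul, Real.coe_toNNReal _ hv] at h2
  simp_rw [sub_eq_add_neg, Real.exp_add]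
  rw [integral_mul_const, h2]
  norm_num

/-- Truncated exponential moments converge along a sequence that converges in distribution. -/
lemma tendsto_lintegral_exp_min {Ω Ω' : Type*} [MeasurableSpace Ω] [MeasurableSpace Ω']
    {P : Measure Ω} [IsProbabilityMeasure P] {P' : Measure Ω'} [IsProbabilityMeasure P']
    {X : ℕ → Ω → ℝ} {Z : Ω' → ℝ} (h : TendstoInDistribution X atTop Z (fun _ => P) P') (m : ℝ) :
    Tendsto (fun T => ∫⁻ ω, ENNReal.ofReal (Real.exp (min (X T ω) m)) ∂P) atTop
      (𝓝 (∫⁻ ω, ENNReal.ofReal (Real.exp (min (Z ω) m)) ∂P')) := by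
  have hcont : Continuous fun x : ℝ => (Real.exp (min x m)).toNNReal := by fun_prop
  let f : BoundedContinuousFunction ℝ NNReal :=
    BoundedContinuousFunction.mkOfBound ⟨_, hcont⟩ (Real.exp m) (by
      intro x y
      simp only [ContinuousMap.coe_mk, NNReal.dist_eq, Real.coe_toNNReal _ (Real.exp_pos _).le]
      have hx : Real.exp (min x m) ≤ Real.exp m := Real.exp_le_exp.2 (min_le_right _ _)
      have hy : Real.exp (min y m) ≤ Real.exp m := Real.exp_le_exp.2 (min_le_right _ _)
      have hx' := Real.exp_pos (min x m)
      have hy' := Real.exp_pos (min y m)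
      rw [abs_le]
      constructor <;> linarith)
  have h1 := ProbabilityMeasure.tendsto_iff_forall_lintegral_tendsto.1 h.tendsto f
  have hf : ∀ x, (f x : ENNReal) = ENNReal.ofReal (Real.exp (min x m)) := fun x => rfl
  have hmeas : Measurable fun x : ℝ => ENNReal.ofReal (Real.exp (min x m)) := by fun_prop
  simp only [hf, ProbabilityMeasure.coe_mk] at h1
  rw [lintegral_map' hmeas.aemeasurable h.aemeasurable_limit] at h1
  refine h1.congr fun T => ?_
  rw [lintegral_map' hmeas.aemeasurable (h.forall_aemeasurable T)]

variable {𝒴 : Type*} [MeasurableSpace 𝒴] {d q : ℕ} {ν : Measure 𝒴} {Θ : Set (Par d)}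
  {p : (t : ℕ) → (Fin t → 𝒴) → 𝒴 → Par d → ℝ}
  {Ω : Type*} [MeasurableSpace Ω] {P : Measure Ω} [IsProbabilityMeasure P]
  {Y : ℕ → Ω → 𝒴} {Ysim : Par d → ℕ → Ω → 𝒴} {β₀ : Par d} {L : Par d → Par d}
  {J : Par d → Matrix (Fin d) (Fin d) ℝ} {I₀ J₀ : Matrix (Fin d) (Fin d) ℝ}

/-- The information equality: the asymptotic variance of the score is the limit of the negative
Hessian. The log-likelihood ratios at local parameters have a Gaussian limit, and their
exponentials are uniformly integrable with mean one. -/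
lemma ObservedRegularity.information_eq (hobs : ObservedRegularity P Θ p Y β₀ 0 I₀ J₀)
    (hlim : SimulatedLimits P Θ p Ysim β₀ L J)
    (hs : ∀ θ ∈ Θ, ∀ T, ∀ᵐ ω ∂P, IsSmoothSample Θ p (sample (Ysim θ) T ω))
    (hp : IsCondDensityFamily ν Θ p) (hβ₀ : β₀ ∈ interior Θ)
    (hY : ∀ T, HasLaw (sample Y T) (sampleLaw ν p T β₀) P)
    (hYsim : ∀ θ ∈ Θ, ∀ T, HasLaw (sample (Ysim θ) T) (sampleLaw ν p T θ) P) (h : Par d) :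
    inner ℝ h (matMap I₀ h) = inner ℝ h (matMap J₀ h) := by
  classical
  have hgood : ∀ᶠ T : ℕ in atTop, β₀ + (√(T : ℝ))⁻¹ • h ∈ interior Θ := by
    have : Tendsto (fun T : ℕ => β₀ + (√(T : ℝ))⁻¹ • h) atTop (𝓝 (β₀ + (0 : ℝ) • h)) :=
      tendsto_const_nhds.add (tendsto_inv_sqrt_natCast.smul_const h)
    rw [zero_smul, add_zero] at this
    exact this.eventually (isOpen_interior.mem_nhds hβ₀)
  -- The value `0` is used only for finitely many `T`; it secures measurability for every `T`.
  let X : ℕ → Ω → ℝ := fun T ω =>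
    if β₀ + (√(T : ℝ))⁻¹ • h ∈ interior Θ then localLogRatio p (sample Y T ω) β₀ h else 0
  have hX : ∀ T : ℕ, β₀ + (√(T : ℝ))⁻¹ • h ∈ interior Θ →
      X T = fun ω => localLogRatio p (sample Y T ω) β₀ h := by
    intro T hT
    funext ω
    simp [X, hT]
  have hXm : ∀ T, AEMeasurable (X T) P := by
    intro T
    by_cases hT : β₀ + (√(T : ℝ))⁻¹ • h ∈ interior Θ
    · rw [hX T hT]
      exact ((aemeasurable_crit hp (hY T).aemeasurable (interior_subset hT)).sub
        (aemeasurable_crit hp (hY T).aemeasurable (interior_subset hβ₀))).const_mul _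
    · simp [X, hT]
  set c : ℝ := inner ℝ h (matMap J₀ h) / 2 with hc
  have hW := hobs.score_clt.continuous_comp (g := fun z => inner ℝ h z - c) (by fun_prop)
  have hXZ : TendstoInDistribution X atTop (fun z : Par d => inner ℝ h z - c) (fun _ => P)
      (multivariateGaussian 0 I₀) := by
    refine tendstoInDistribution_of_tendstoInMeasure_sub X _ hW ?_ hXm
    rw [tendstoInMeasure_iff_withHighProb]
    intro ε hε
    refine (hobs.localLogRatio_lim hp (fun T => (hY T).aemeasurable) hβ₀ h hε).mono ?_
    filter_upwards [hgood] with T hT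
    refine ae_of_all _ fun ω hω => ?_
    rw [real_inner_comm, real_inner_comm h (matMap J₀ h), ← hc] at hω
    simpa [congrFun (hX T hT) ω] using hω
  let a : ℝ → ENNReal := fun m =>
    ∫⁻ z, ENNReal.ofReal (Real.exp (min (inner ℝ h z - c) m)) ∂(multivariateGaussian 0 I₀)
  have ha : ∀ m, Tendsto (fun T => ∫⁻ ω, ENNReal.ofReal (Real.exp (min (X T ω) m)) ∂P) atTop
      (𝓝 (a m)) := fun m => tendsto_lintegral_exp_min hXZ m
  have hprob : ∀ θ ∈ Θ, ∀ T, IsProbabilityMeasure (sampleLaw ν p T θ) := fun θ hθ T =>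
    (hYsim θ hθ T).isProbabilityMeasure_iff.1 inferInstance
  have hβΘ := interior_subset hβ₀
  have ha_le : ∀ m, a m ≤ 1 := by
    intro m
    refine le_of_tendsto (ha m) ?_
    filter_upwards [hgood] with T hT
    have := hprob _ (interior_subset hT) T
    refine le_trans (lintegral_mono fun ω => ?_) (lintegral_likelihoodRatio_le_one hp hβΘ
      (interior_subset hT) (hY T) measure_univ.le
      (by filter_upwards [hobs.smooth T] with ω hω using hω.1 _ hβ₀)
      (by filter_upwards [hobs.smooth T] with ω hω using hω.1 _ hT))
    rw [hX T hT]
    exact ENNReal.ofReal_le_ofReal (Real.exp_le_exp.2 (min_le_left _ _))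
  -- The truncation loses at most the probability, under the local alternative, that the log-ratio
  -- exceeds `m`. Tightness makes this small with `m` independent of `T`.
  have ha_ge : ∀ η : ENNReal, 0 < η → ∃ m, 1 ≤ a m + η := by
    intro η hη
    obtain ⟨m, hm⟩ := hlim.localLogRatio_tight hs hp hβ₀ hYsim h hη
    refine ⟨m, ge_of_tendsto ((ha m).add_const η) ?_⟩
    filter_upwards [hgood, hm] with T hT hmT
    have hT' := interior_subset hT
    have h1 := measure_logRatio_le_le_lintegral hp hβΘ hT' (hY T) (hYsim _ hT' T)
      (by filter_upwards [hs _ hT' T] with ω hω using hω.1 _ hβ₀)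
      (by filter_upwards [hs _ hT' T] with ω hω using hω.1 _ hT) m
    rw [hX T hT]
    refine le_trans ?_ (add_le_add h1 hmT)
    rw [← measure_univ (μ := P)]
    refine le_trans (measure_mono ?_) (measure_union_le _ _)
    intro ω _
    exact em _
  let A : ENNReal := ∫⁻ z, ENNReal.ofReal (Real.exp (inner ℝ h z - c)) ∂(multivariateGaussian 0 I₀)
  -- Fatou's lemma along integer truncation levels, each truncation being eventually inactive at a
  -- given point.
  have hA1 : A ≤ 1 := by
    have hpt : ∀ z : Par d, ENNReal.ofReal (Real.exp (inner ℝ h z - c)) =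
        liminf (fun m : ℕ => ENNReal.ofReal (Real.exp (min (inner ℝ h z - c) m))) atTop := by
      intro z
      refine (Tendsto.liminf_eq (tendsto_const_nhds.congr' ?_)).symm
      obtain ⟨n, hn⟩ := exists_nat_ge (inner ℝ h z - c)
      filter_upwards [eventually_ge_atTop n] with m hm
      rw [min_eq_left (hn.trans (Nat.cast_le.2 hm))]
    calc A = ∫⁻ z, liminf (fun m : ℕ => ENNReal.ofReal (Real.exp (min (inner ℝ h z - c) m)))
          atTop ∂(multivariateGaussian 0 I₀) := lintegral_congr hpt
      _ ≤ liminf (fun m : ℕ => a m) atTop := lintegral_liminf_le fun m => by fun_prop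
      _ ≤ 1 := liminf_le_of_le (by isBoundedDefault) fun b hb => by
          obtain ⟨m, hm⟩ := hb.exists
          exact hm.trans (ha_le m)
  have hA2 : 1 ≤ A := by
    refine ENNReal.le_of_forall_pos_le_add fun η hη _ => ?_
    obtain ⟨m, hm⟩ := ha_ge η (by exact_mod_cast hη)
    refine hm.trans (add_le_add_left (lintegral_mono fun z => ?_) _)
    exact ENNReal.ofReal_le_ofReal (Real.exp_le_exp.2 (min_le_left _ _))
  have hA : A = 1 := le_antisymm hA1 hA2
  simp only [A] at hA
  rw [lintegral_exp_inner_multivariateGaussian hobs.posDef_I.posSemidef, ENNReal.ofReal_eq_one,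
    Real.exp_eq_one_iff, hc] at hA
  linarith

end InformationEquality

end ScoreTest

namespace ScoreTest

/-! ### Linear algebra of the constrained first-order conditions. -/

section Algebra

open ContinuousLinearMap

variable {E : Type*} [NormedAddCommGroup E] [InnerProductSpace ℝ E]

lemma tendsto_clm_apply {F : Type*} [NormedAddCommGroup F] [NormedSpace ℝ F] {u : ℕ → E →L[ℝ] F}
    {x : ℕ → E} {A : E →L[ℝ] F} {a : E} (hu : Tendsto u atTop (𝓝 A))
    (hx : Tendsto x atTop (𝓝 a)) : Tendsto (fun n => u n (x n)) atTop (𝓝 (A a)) :=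
  (isBoundedBilinearMap_apply.continuous.tendsto (A, a)).comp (hu.prodMk_nhds hx)

lemma exists_equiv_of_injective [FiniteDimensional ℝ E] {A : E →L[ℝ] E} (hA : Function.Injective A) :
    ∃ e : E ≃L[ℝ] E, (e : E →L[ℝ] E) = A := by
  refine ⟨(LinearEquiv.ofInjectiveEndo (A : E →ₗ[ℝ] E) hA).toContinuousLinearEquiv, ?_⟩
  ext x
  rfl

lemma injective_of_inner_pos {A : E →L[ℝ] E} (hA : ∀ x, x ≠ 0 → 0 < inner ℝ x (A x)) :
    Function.Injective A := by
  rw [injective_iff_map_eq_zero]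
  intro x hx
  by_contra h
  have := hA x h
  rw [hx, inner_zero_right] at this
  exact lt_irrefl _ this

variable [FiniteDimensional ℝ E]

lemma tendsto_clm_inverse {A : E →L[ℝ] E} (hA : Function.Injective A) {u : ℕ → E →L[ℝ] E}
    (hu : Tendsto u atTop (𝓝 A)) : Tendsto (fun n => (u n).inverse) atTop (𝓝 A.inverse) := by
  obtain ⟨e, rfl⟩ := exists_equiv_of_injective hA
  exact (contDiffAt_map_inverse (n := 1) e).continuousAt.tendsto.comp hu

lemma inverse_apply_self {A : E →L[ℝ] E} (hA : Function.Injective A) (x : E) :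
    A.inverse (A x) = x := by
  obtain ⟨e, rfl⟩ := exists_equiv_of_injective hA
  simp

lemma apply_inverse_self {A : E →L[ℝ] E} (hA : Function.Injective A) (x : E) :
    A (A.inverse x) = x := by
  obtain ⟨e, rfl⟩ := exists_equiv_of_injective hA
  simp

open scoped MatrixOrder in
/-- A positive definite operator has a symmetric inverse square root. -/
lemma exists_inverse_sqrt {q : ℕ} {S : Par q →L[ℝ] Par q}
    (hsymm : ∀ x y, inner ℝ (S x) y = inner ℝ x (S y))
    (hpos : ∀ x, x ≠ 0 → 0 < inner ℝ x (S x)) :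
    ∃ C : Par q →L[ℝ] Par q, (∀ x y, inner ℝ (C x) y = inner ℝ x (C y)) ∧
      (∀ x, C (S (C x)) = x) ∧ ∀ x, C (C (S x)) = x := by
  let N : Matrix (Fin q) (Fin q) ℝ := (Matrix.toEuclideanCLM (n := Fin q) (𝕜 := ℝ)).symm S
  have hN : matMap N = S := (Matrix.toEuclideanCLM (n := Fin q) (𝕜 := ℝ)).apply_symm_apply S
  have hNpsd : N.PosDef := by
    rw [Matrix.posDef_iff_dotProduct_mulVec]
    constructor
    · rw [← Matrix.isSymmetric_toEuclideanLin_iff]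
      intro x y
      have := hsymm x y
      rw [← hN] at this
      exact this
    · intro x hx
      have h1 := hpos (WithLp.toLp 2 x) (by simpa using hx)
      rw [← hN, Matrix.inner_toEuclideanCLM] at h1
      simpa using h1
  let R : Par q →L[ℝ] Par q := matMap (CFC.sqrt N)
  have hRR : ∀ x, R (R x) = S x := by
    intro x
    have h1 : R * R = S := by
      simp only [R, matMap]
      rw [← map_mul, CFC.sqrt_mul_sqrt_self _ hNpsd.posSemidef.nonneg]
      exact hN
    rw [← h1]
    rfl
  have hRsymm : ∀ x y, inner ℝ (R x) y = inner ℝ x (R y) := by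
    have h1 : IsSelfAdjoint R := (CFC.sqrt_nonneg N).isSelfAdjoint.map _
    intro x y
    rw [← ContinuousLinearMap.adjoint_inner_right, h1.adjoint_eq]
  have hRinj : Function.Injective R := by
    intro x y hxy
    apply injective_of_inner_pos hpos
    rw [← hRR, ← hRR, hxy]
  refine ⟨R.inverse, fun x y => ?_, fun x => ?_, fun x => ?_⟩
  · conv_lhs => rw [← apply_inverse_self hRinj y]
    rw [← hRsymm, apply_inverse_self hRinj]
  · rw [← hRR, apply_inverse_self hRinj, inverse_apply_self hRinj]
  · rw [← hRR, inverse_apply_self hRinj, inverse_apply_self hRinj]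

/-- The linear map that standardizes the score in the directions of the constraints. -/
lemma exists_standardizing_map {q : ℕ} {A : E →L[ℝ] E}
    (hsymm : ∀ x y, inner ℝ (A x) y = inner ℝ x (A y))
    (hpos : ∀ x, x ≠ 0 → 0 < inner ℝ x (A x)) {G : E →L[ℝ] Par q}
    (hG : Function.Surjective G) :
    ∃ M : E →L[ℝ] Par q, (∀ t, inner ℝ (adjoint M t) (A (adjoint M t)) = ‖t‖ ^ 2) ∧
      ∀ z u l, G u = 0 → z - A u = adjoint G l →
        inner ℝ (A.inverse (z - A u)) (z - A u) = ‖M z‖ ^ 2 := by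
  have hA := injective_of_inner_pos hpos
  have hBsymm : ∀ x y, inner ℝ (A.inverse x) y = inner ℝ x (A.inverse y) := by
    intro x y
    conv_lhs => rw [← apply_inverse_self hA y]
    rw [← hsymm, apply_inverse_self hA]
  have hBpos : ∀ x, x ≠ 0 → 0 < inner ℝ x (A.inverse x) := by
    intro x hx
    have h1 : A.inverse x ≠ 0 := by
      intro h
      apply hx
      rw [← apply_inverse_self hA x, h, map_zero]
    have := hpos _ h1
    rwa [apply_inverse_self hA, real_inner_comm] at this
  have hGadj : ∀ x, x ≠ 0 → adjoint G x ≠ 0 := by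
    intro x hx h
    obtain ⟨y, rfl⟩ := hG x
    apply hx
    rw [← inner_self_eq_zero (𝕜 := ℝ), ← adjoint_inner_left, h, inner_zero_left]
  -- Positive definite, because surjectivity of `G` makes its adjoint injective. The map `C` below
  -- is `S^(-1/2)`.
  let S : Par q →L[ℝ] Par q := G ∘L A.inverse ∘L adjoint G
  have hS : ∀ x, S x = G (A.inverse (adjoint G x)) := fun x => rfl
  obtain ⟨C, hC1, hC2, hC3⟩ := exists_inverse_sqrt (S := S)
    (fun x y => by
      rw [hS, hS, ← adjoint_inner_right, hBsymm, adjoint_inner_left])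
    (fun x hx => by
      rw [hS, ← adjoint_inner_left]
      exact hBpos _ (hGadj x hx))
  let M : E →L[ℝ] Par q := C ∘L G ∘L A.inverse
  have hM : ∀ z, M z = C (G (A.inverse z)) := fun z => rfl
  have hMadj : ∀ t, adjoint M t = A.inverse (adjoint G (C t)) := by
    intro t
    refine ext_inner_right ℝ fun z => ?_
    rw [adjoint_inner_left, hM, ← hC1, hBsymm, adjoint_inner_left]
  refine ⟨M, fun t => ?_, fun z u l hu hw => ?_⟩
  · rw [hMadj, apply_inverse_self hA, adjoint_inner_right, ← hS, ← hC1, hC2,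
      real_inner_self_eq_norm_sq]
  -- As `G u = 0`, `z` may be replaced by `w = G* l`. Then `‖C S l‖² = ⟨S l, l⟩ = ⟨A⁻¹ w, w⟩`.
  · have h1 : M z = C (S l) := by
      rw [hM, hS, ← hw, map_sub, inverse_apply_self hA, map_sub, hu, sub_zero]
    rw [h1, ← real_inner_self_eq_norm_sq, hC1, hC3, hS, hw, adjoint_inner_right]

/-- Perturbed solutions of the linearized first-order conditions have a quadratic form that is
close to the one of the exact solution. -/
lemma exists_delta_quadratic {q : ℕ} {A : E →L[ℝ] E} (hA : Function.Injective A)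
    {G : E →L[ℝ] Par q} (hG : Function.Surjective G) {M : E →L[ℝ] Par q}
    (hM : ∀ z u l, G u = 0 → z - A u = adjoint G l →
        inner ℝ (A.inverse (z - A u)) (z - A u) = ‖M z‖ ^ 2) (K : ℝ) {ε : ℝ} (hε : 0 < ε) :
    ∃ δ : ℝ, 0 < δ ∧ ∀ (z u w : E) (G' : E →L[ℝ] Par q) (l : Par q) (H : E →L[ℝ] E),
      ‖z‖ ≤ K → ‖u‖ ≤ K → ‖w - (z - A u)‖ ≤ δ → ‖G u‖ ≤ δ → ‖G' - G‖ ≤ δ →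
      w = adjoint G' l → ‖H + A‖ ≤ δ →
      |-inner ℝ (-(H.inverse w)) (H (-(H.inverse w))) - ‖M z‖ ^ 2| < ε := by
  -- Compactness: counterexamples with `δ = 1 / (n + 1)` have a subsequence along which `z` and `u`,
  -- hence `w`, converge to an exact solution. The multipliers need not be bounded.
  by_contra hcon
  push Not at hcon
  have hδ : ∀ n : ℕ, (0 : ℝ) < 1 / ((n : ℝ) + 1) := fun n => by positivity
  choose z u w G' l H hz hu hw hGu hG' hwl hH hbad using fun n : ℕ => hcon _ (hδ n)
  obtain ⟨⟨z₀, u₀⟩, -, φ, hφ, hlim⟩ := ((isCompact_closedBall (0 : E) K).prod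
    (isCompact_closedBall (0 : E) K)).tendsto_subseq (x := fun n => (z n, u n))
    (fun n => ⟨by simpa using hz n, by simpa using hu n⟩)
  have hlimz : Tendsto (fun n => z (φ n)) atTop (𝓝 z₀) := (continuous_fst.tendsto _).comp hlim
  have hlimu : Tendsto (fun n => u (φ n)) atTop (𝓝 u₀) := (continuous_snd.tendsto _).comp hlim
  have h0 : Tendsto (fun n => 1 / ((φ n : ℝ) + 1)) atTop (𝓝 0) :=
    tendsto_one_div_add_atTop_nhds_zero_nat.comp hφ.tendsto_atTop
  have hlimw : Tendsto (fun n => w (φ n)) atTop (𝓝 (z₀ - A u₀)) := by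
    have h1 := squeeze_zero_norm (fun n => hw (φ n)) h0
    have h2 := h1.add (hlimz.sub ((A.continuous.tendsto _).comp hlimu))
    simpa using h2
  have hGu₀ : G u₀ = 0 :=
    tendsto_nhds_unique ((G.continuous.tendsto _).comp hlimu)
      (squeeze_zero_norm (fun n => hGu (φ n)) h0)
  have hlimG : Tendsto (fun n => G' (φ n)) atTop (𝓝 G) := by
    simpa using (squeeze_zero_norm (fun n => hG' (φ n)) h0).add_const G
  have hlimH : Tendsto (fun n => H (φ n)) atTop (𝓝 (-A)) := by
    simpa using (squeeze_zero_norm (fun n => hH (φ n)) h0).add_const (-A)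
  have hGG : Function.Injective (G ∘L adjoint G) := by
    apply injective_of_inner_pos
    intro x hx
    have h1 : adjoint G x ≠ 0 := by
      intro h
      obtain ⟨y, rfl⟩ := hG x
      apply hx
      rw [← inner_self_eq_zero (𝕜 := ℝ), ← adjoint_inner_left, h, inner_zero_left]
    rw [comp_apply, ← adjoint_inner_left, real_inner_self_eq_norm_sq]
    positivity
  have hlimGG : Tendsto (fun n => G' (φ n) ∘L adjoint (G' (φ n))) atTop (𝓝 (G ∘L adjoint G)) := by
    have hadj : Tendsto (fun n => adjoint (G' (φ n))) atTop (𝓝 (adjoint G)) :=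
      (adjoint.continuous.tendsto _).comp hlimG
    exact (isBoundedBilinearMap_comp.continuous.tendsto (G, adjoint G)).comp
      (hlimG.prodMk_nhds hadj)
  -- Eliminates the multiplier: a vector `w` in the range of `G'*` equals `G'* (G' G'*)⁻¹ G' w` once
  -- `G' G'*` is invertible, which is an open condition. This formula passes to the limit and puts
  -- the limit of `w` in the range of `G*`.
  have hlimw' : Tendsto (fun n => w (φ n)) atTop
      (𝓝 (adjoint G ((G ∘L adjoint G).inverse (G (z₀ - A u₀))))) := by
    have hadj : Tendsto (fun n => adjoint (G' (φ n))) atTop (𝓝 (adjoint G)) :=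
      (adjoint.continuous.tendsto _).comp hlimG
    have h1 := tendsto_clm_apply hadj
      (tendsto_clm_apply (tendsto_clm_inverse hGG hlimGG) (tendsto_clm_apply hlimG hlimw))
    refine h1.congr' ?_
    obtain ⟨e, he⟩ := exists_equiv_of_injective hGG
    rw [← he] at hlimGG
    filter_upwards [hlimGG.eventually (ContinuousLinearEquiv.isOpen.mem_nhds ⟨e, rfl⟩)] with n hn
    obtain ⟨e', he'⟩ := hn
    have hinj : Function.Injective (G' (φ n) ∘L adjoint (G' (φ n))) := by
      rw [← he']
      exact e'.injective
    have h2 := inverse_apply_self hinj (l (φ n))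
    rw [comp_apply, ← hwl] at h2
    rw [h2, ← hwl]
  have hrange := tendsto_nhds_unique hlimw hlimw'
  have hval := hM z₀ u₀ _ hGu₀ hrange
  have hnegA : Function.Injective (-A : E →L[ℝ] E) := by
    intro x y hxy
    exact hA (neg_injective (by simpa using hxy))
  have hinv := tendsto_clm_apply (tendsto_clm_inverse hnegA hlimH) hlimw
  have hstat := ((hinv.neg).inner (tendsto_clm_apply hlimH hinv.neg)).neg.sub
    ((continuous_norm.tendsto _).comp ((M.continuous.tendsto _).comp hlimz) |>.pow 2)
  have hneg : -((-A : E →L[ℝ] E).inverse (z₀ - A u₀)) = A.inverse (z₀ - A u₀) := by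
    have h1 := apply_inverse_self hnegA (z₀ - A u₀)
    conv_rhs => rw [← h1]
    rw [neg_apply, map_neg, inverse_apply_self hA]
  rw [hneg, neg_apply, apply_inverse_self hA, inner_neg_right, neg_neg, hval, sub_self] at hstat
  have hfin := (tendsto_zero_iff_norm_tendsto_zero.1 hstat).eventually_lt_const hε
  obtain ⟨n, hn⟩ := hfin.exists
  exact absurd hn (not_lt.2 (hbad (φ n)))

end Algebra

/-! ### Gaussian vectors and the chi-squared law. -/

section ChiSquared

lemma stdGaussian_map_norm_sq (q : ℕ) :
    (stdGaussian (Par q)).map (fun x => ‖x‖ ^ 2) = chiSquared q := by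
  rw [← map_pi_eq_stdGaussian, Measure.map_map (by fun_prop) (by fun_prop), chiSquared]
  congr 1
  funext z
  simp [EuclideanSpace.real_norm_sq_eq]

/-- A linear map that standardizes the covariance maps a centered Gaussian law to the standard
Gaussian law. -/
lemma map_multivariateGaussian_eq_stdGaussian {d q : ℕ} {S : Matrix (Fin d) (Fin d) ℝ}
    (hS : S.PosSemidef) {M : Par d →L[ℝ] Par q}
    (hM : ∀ t, inner ℝ (ContinuousLinearMap.adjoint M t)
      (matMap S (ContinuousLinearMap.adjoint M t)) = ‖t‖ ^ 2) :
    (multivariateGaussian 0 S).map M = stdGaussian (Par q) := by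
  have : IsProbabilityMeasure ((multivariateGaussian 0 S).map M) :=
    Measure.isProbabilityMeasure_map (by fun_prop)
  refine Measure.ext_of_charFun (funext fun t => ?_)
  rw [charFun_stdGaussian, charFun_apply, integral_map (by fun_prop) (by fun_prop)]
  have h1 := charFun_multivariateGaussian (μ := 0) hS (ContinuousLinearMap.adjoint M t)
  rw [← Matrix.inner_toEuclideanCLM, hM, charFun_apply] at h1
  simp only [ContinuousLinearMap.adjoint_inner_right] at h1
  rw [h1]
  simp [neg_div]

end ChiSquared

end ScoreTest

namespace ScoreTest

/-! ### Quadratic approximation of the score statistic. -/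

section ScoreStatistic

variable {𝒴 : Type*} {d q : ℕ} {Θ : Set (Par d)}
  {p : (t : ℕ) → (Fin t → 𝒴) → 𝒴 → Par d → ℝ}

/-- The score statistic is a quadratic form of the rescaled score at the constrained estimate. -/
lemma scoreStat_eq {T : ℕ} {y : Fin T → 𝒴} {b : Par d} (hb : b ∈ interior Θ) :
    scoreStat Θ p y b =
      -inner ℝ (-((hess p y b).inverse (√(T : ℝ) • score p y b)))
        (hess p y b (-((hess p y b).inverse (√(T : ℝ) • score p y b)))) := by
  have hT : √(T : ℝ) * √(T : ℝ) = T := Real.mul_self_sqrt (Nat.cast_nonneg T)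
  simp only [scoreStat, Set.indicator_of_mem hb, func, sub_sub_cancel_left, map_neg, map_smul,
    inner_neg_neg, real_inner_smul_left, real_inner_smul_right]
  rw [← mul_assoc, hT]

variable [MeasurableSpace 𝒴] {ν : Measure 𝒴}
  {Ω : Type*} [MeasurableSpace Ω] {P : Measure Ω}
  {Y : ℕ → Ω → 𝒴} {β₀ : Par d} {I₀ J₀ : Matrix (Fin d) (Fin d) ℝ}

lemma IsRootConsistent.boundedInProb {b : ℕ → Ω → Par d} (h : IsRootConsistent P b β₀) :
    BoundedInProb P fun T ω => √(T : ℝ) • (b T ω - β₀) := by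
  intro ε hε
  obtain ⟨M, hM⟩ := h ε hε
  refine ⟨M, ?_⟩
  simpa only [norm_smul, Real.norm_of_nonneg (Real.sqrt_nonneg _)] using hM

variable [IsProbabilityMeasure P]

/-- The score statistic is asymptotically a quadratic form of the score at the pseudo-true
value. -/
lemma ObservedRegularity.scoreStat_sub_lim (hobs : ObservedRegularity P Θ p Y β₀ 0 I₀ J₀)
    (hp : IsCondDensityFamily ν Θ p) (hY : ∀ T, AEMeasurable (sample Y T) P)
    (hβ₀ : β₀ ∈ interior Θ) {g : Par d → EuclideanSpace ℝ (Fin q)}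
    (hg : ContDiffOn ℝ 2 g (interior Θ)) (hgβ₀ : g β₀ = 0)
    (hsurj : Function.Surjective (fderiv ℝ g β₀)) {b : ℕ → Ω → Par d}
    (hb : IsConstrainedEstimator P Θ p g Y b) (hroot : IsRootConsistent P b β₀)
    (hA : Function.Injective (matMap J₀)) {M : Par d →L[ℝ] Par q}
    (hM : ∀ z u l, fderiv ℝ g β₀ u = 0 →
      z - matMap J₀ u = ContinuousLinearMap.adjoint (fderiv ℝ g β₀) l →
        inner ℝ ((matMap J₀).inverse (z - matMap J₀ u)) (z - matMap J₀ u) = ‖M z‖ ^ 2)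
    {ε : ℝ} (hε : 0 < ε) :
    WithHighProb P fun T ω => |scoreStat Θ p (sample Y T ω) (b T ω) -
      ‖M (√(T : ℝ) • score p (sample Y T ω) β₀)‖ ^ 2| < ε := by
  have hz : BoundedInProb P fun T ω => √(T : ℝ) • score p (sample Y T ω) β₀ := by
    simpa only [sub_zero] using BoundedInProb.of_tendstoInDistribution hobs.score_clt
  refine WithHighProb.of_bounded hz fun K₁ => ?_
  refine WithHighProb.of_bounded hroot.boundedInProb fun K₂ => ?_
  let K : ℝ := max (max K₁ K₂) 0
  have hK0 : 0 ≤ K := le_max_right _ _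
  obtain ⟨δ, hδ, hstat⟩ := exists_delta_quadratic hA hsurj hM K hε
  -- Chosen so that both `ε'` and `ε' K` are at most `δ`: the Hessian error is `ε'`, and the
  -- rescaled linearization errors are at most `ε' K`.
  let ε' : ℝ := δ / (K + 1)
  have hε' : 0 < ε' := by positivity
  have hε'K : ε' * K ≤ δ := by
    have : ε' * (K + 1) = δ := div_mul_cancel₀ _ (by positivity)
    nlinarith
  have hε'δ : ε' ≤ δ := div_le_self hδ.le (by linarith)
  let r : ℕ → ℝ := fun T => (√(T : ℝ))⁻¹ * (K + 1)
  have hr0 : ∀ᶠ T in atTop, 0 < r T := by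
    filter_upwards [eventually_gt_atTop 0] with T hT
    have : (0 : ℝ) < T := by exact_mod_cast hT
    positivity
  have hr : Tendsto r atTop (𝓝 0) := by
    simpa using tendsto_inv_sqrt_natCast.mul_const (K + 1)
  have hgat : ContDiffAt ℝ 2 g β₀ := hg.contDiffAt (isOpen_interior.mem_nhds hβ₀)
  have hgd : HasFDerivAt g (fderiv ℝ g β₀) β₀ :=
    (hgat.differentiableAt (by norm_num)).hasFDerivAt
  have hgc : ∀ᶠ x in 𝓝 β₀, ‖fderiv ℝ g x - fderiv ℝ g β₀‖ ≤ δ := by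
    have hcont : ContinuousAt (fderiv ℝ g) β₀ := hgat.continuousAt_fderiv (by norm_num)
    filter_upwards [Metric.tendsto_nhds.1 hcont δ hδ] with x hx
    rw [← dist_eq_norm]
    exact hx.le
  have hglin : ∀ᶠ x in 𝓝 β₀,
      ‖g x - g β₀ - fderiv ℝ g β₀ (x - β₀)‖ ≤ ε' * ‖x - β₀‖ := hgd.isLittleO.def hε'
  obtain ⟨ρ, hρ, hball⟩ := Metric.eventually_nhds_iff_ball.1 (hgc.and hglin)
  refine ((hobs.hess_unif hp hY hβ₀ hr0 hr hε').and hb.2).mono ?_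
  filter_upwards [eventually_gt_atTop 0, eventually_ball_subset_interior hβ₀ hr,
    hr.eventually_lt_const hρ] with T hT hTint hTρ
  have hT0 : (0 : ℝ) < T := by exact_mod_cast hT
  have hsT : 0 < √(T : ℝ) := Real.sqrt_pos.2 hT0
  filter_upwards [hobs.smooth T] with ω hω
  rintro ⟨hH, hbint, hgb, l, hl⟩ hu hz'
  set y := sample Y T ω
  set v := b T ω - β₀ with hv
  have hbv : β₀ + v = b T ω := add_sub_cancel _ _
  have huK : ‖√(T : ℝ) • v‖ ≤ K := hu.trans ((le_max_right _ _).trans (le_max_left _ _))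
  have hzK : ‖√(T : ℝ) • score p y β₀‖ ≤ K := hz'.trans ((le_max_left _ _).trans (le_max_left _ _))
  have hnorm : √(T : ℝ) * ‖v‖ ≤ K := by
    rwa [norm_smul, Real.norm_of_nonneg hsT.le] at huK
  have hvr : ‖v‖ < r T := by
    simp only [r]
    rw [inv_mul_eq_div, lt_div_iff₀ hsT]
    linarith
  have hsmall : √(T : ℝ) * (ε' * ‖v‖) ≤ δ := by
    rw [mul_left_comm]
    exact (mul_le_mul_of_nonneg_left hnorm hε'.le).trans hε'K
  obtain ⟨h1, h2⟩ := hball (b T ω) (by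
    rw [mem_ball_iff_norm]
    exact hvr.trans hTρ)
  rw [scoreStat_eq hbint]
  -- The first-order condition gives the exact range relation at the derivative of `g` at the
  -- estimate, with the multiplier rescaled and its sign reversed.
  refine hstat _ (√(T : ℝ) • v) _ (fderiv ℝ g (b T ω)) (-(√(T : ℝ) • l)) _ hzK huK ?_ ?_ h1 ?_
    ((hH _ hvr).trans hε'δ)
  · have h3 := hω.norm_score_sub_le hTint hH hvr
    rw [hbv] at h3
    have e : √(T : ℝ) • score p y (b T ω) - (√(T : ℝ) • score p y β₀ -
        matMap J₀ (√(T : ℝ) • v)) =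
        √(T : ℝ) • (score p y (b T ω) - score p y β₀ + matMap J₀ v) := by
      rw [map_smul, smul_add, smul_sub]
      abel
    rw [e, norm_smul, Real.norm_of_nonneg hsT.le]
    exact (mul_le_mul_of_nonneg_left h3 hsT.le).trans hsmall
  · rw [hgb, hgβ₀, sub_zero, zero_sub, norm_neg] at h2
    rw [map_smul, norm_smul, Real.norm_of_nonneg hsT.le]
    exact (mul_le_mul_of_nonneg_left h2 hsT.le).trans hsmall
  · rw [map_neg, map_smul, eq_neg_of_add_eq_zero_left hl, smul_neg]

end ScoreStatistic

end ScoreTest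

/-! ### The limit law of the score statistic. -/

theorem corollary1
    {𝒴 : Type*} [MeasurableSpace 𝒴] (ν : Measure 𝒴) [SigmaFinite ν]
    {Ω : Type*} [MeasurableSpace Ω] (P : Measure Ω) [IsProbabilityMeasure P]
    {d q : ℕ} (Θ : Set (ScoreTest.Par d)) (hΘ : IsCompact Θ)
    -- the parametric model, the true value, the data and the simulated paths
    (p : (t : ℕ) → (Fin t → 𝒴) → 𝒴 → ScoreTest.Par d → ℝ)
    (hp : ScoreTest.IsCondDensityFamily ν Θ p)
    (θ₀ : ScoreTest.Par d) (hθ₀ : θ₀ ∈ interior Θ)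
    (Y : ℕ → Ω → 𝒴)
    (hY : ∀ T, HasLaw (ScoreTest.sample Y T) (ScoreTest.sampleLaw ν p T θ₀) P)
    (Ysim : ScoreTest.Par d → ℕ → Ω → 𝒴)
    (hYsim : ∀ θ ∈ Θ, ∀ T,
      HasLaw (ScoreTest.sample (Ysim θ) T) (ScoreTest.sampleLaw ν p T θ) P)
    -- the constraints
    (g : ScoreTest.Par d → EuclideanSpace ℝ (Fin q))
    (hg : ContDiffOn ℝ 2 g (interior Θ))
    (hrank : Module.finrank ℝ (LinearMap.range (fderiv ℝ g θ₀).toLinearMap) = q)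
    -- the pseudo-true value and the constrained estimator
    (β₀ : ScoreTest.Par d) (hβ₀ : ScoreTest.IsPseudoTrue P Θ p g Y β₀)
    (b : ℕ → Ω → ScoreTest.Par d) (hb : ScoreTest.IsConstrainedEstimator P Θ p g Y b)
    -- the regularity assumptions
    (L : ScoreTest.Par d → ScoreTest.Par d)
    (J : ScoreTest.Par d → Matrix (Fin d) (Fin d) ℝ)
    (I₀ J₀ : Matrix (Fin d) (Fin d) ℝ)
    (hobs : ScoreTest.ObservedRegularity P Θ p Y β₀ (L θ₀) I₀ J₀)
    (hroot : ScoreTest.IsRootConsistent P b β₀)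
    (hsim : ScoreTest.SimulatedRegularity P Θ p g Ysim)
    (hlim : ScoreTest.SimulatedLimits P Θ p Ysim β₀ L J)
    (hL : ContDiffOn ℝ 1 L (interior Θ))
    (hLrank : Module.finrank ℝ (LinearMap.range (fderiv ℝ L θ₀).toLinearMap) = d)
    -- the null hypothesis
    (hnull : g θ₀ = 0) :
    TendstoInDistribution
      (fun (T : ℕ) ω => ScoreTest.scoreStat Θ p (ScoreTest.sample Y T ω) (b T ω)) atTop
      id (fun _ => P) (ScoreTest.chiSquared q) := by
  have hmass : ∀ θ ∈ Θ, ∀ T, ScoreTest.sampleLaw ν p T θ Set.univ ≤ 1 := by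
    intro θ hθ T
    have := (hYsim θ hθ T).isProbabilityMeasure_iff.1 inferInstance
    exact measure_univ.le
  obtain rfl : θ₀ = β₀ := hβ₀.eq_of_null hp hθ₀ hnull hY hmass hobs.smooth
  have hL₀ : L θ₀ = 0 := hobs.limit_eq_zero hp hθ₀ hY hmass
  rw [hL₀] at hobs
  have hYm : ∀ T, AEMeasurable (ScoreTest.sample Y T) P := fun T => (hY T).aemeasurable
  have hinfo := hobs.information_eq hlim hsim.smooth hp hθ₀ hY hYsim
  have hsymm : ∀ x y, inner ℝ (ScoreTest.matMap J₀ x) y = inner ℝ x (ScoreTest.matMap J₀ y) :=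
    Matrix.isSymmetric_toEuclideanLin_iff.2 hobs.posDef_J.isHermitian
  have hpos : ∀ x, x ≠ 0 → 0 < inner ℝ x (ScoreTest.matMap J₀ x) := by
    intro x hx
    rw [Matrix.inner_toEuclideanCLM]
    simpa using (Matrix.posDef_iff_dotProduct_mulVec.1 hobs.posDef_J).2 (x := x.ofLp)
      (by simpa using hx)
  have hsurj : Function.Surjective (fderiv ℝ g θ₀) := by
    have hrange : LinearMap.range (fderiv ℝ g θ₀).toLinearMap = ⊤ :=
      Submodule.eq_top_of_finrank_eq (by rw [hrank, finrank_euclideanSpace_fin])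
    exact LinearMap.range_eq_top.1 hrange
  obtain ⟨M, hM1, hM2⟩ := ScoreTest.exists_standardizing_map hsymm hpos hsurj
  -- `M` standardizes `J₀` by construction; the information equality makes it standardize `I₀`, the
  -- covariance of the limiting score.
  have hlaw : (multivariateGaussian 0 I₀).map (fun z => ‖M z‖ ^ 2) = ScoreTest.chiSquared q := by
    rw [← ScoreTest.stdGaussian_map_norm_sq,
      ← ScoreTest.map_multivariateGaussian_eq_stdGaussian hobs.posDef_I.posSemidef
        (fun t => (hinfo _).trans (hM1 t)), Measure.map_map (by fun_prop) (by fun_prop)]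
    rfl
  have hquad := hobs.score_clt.continuous_comp (g := fun z => ‖M z‖ ^ 2) (by fun_prop)
  have hfinal : TendstoInDistribution
      (fun (T : ℕ) ω => ScoreTest.scoreStat Θ p (ScoreTest.sample Y T ω) (b T ω)) atTop
      (fun z => ‖M z‖ ^ 2) (fun _ => P) (multivariateGaussian 0 I₀) := by
    refine tendstoInDistribution_of_tendstoInMeasure_sub _ _ hquad ?_
      fun T => ScoreTest.aemeasurable_scoreStat hp (hYm T) (hobs.smooth T) (hb.1 T)
    rw [ScoreTest.tendstoInMeasure_iff_withHighProb]
    intro ε hε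
    have h1 := hobs.scoreStat_sub_lim hp hYm hθ₀ hg hnull hsurj hb hroot
      (ScoreTest.injective_of_inner_pos hpos) hM2 hε
    simpa using h1
  -- Only the law of the limit variable matters, so it may be realized as the identity under
  -- `chiSquared q`.
  refine ⟨hfinal.forall_aemeasurable, aemeasurable_id, ?_⟩
  have hlim_eq : (⟨(ScoreTest.chiSquared q).map id, Measure.isProbabilityMeasure_map
      aemeasurable_id⟩ : ProbabilityMeasure ℝ) =
      ⟨(multivariateGaussian 0 I₀).map (fun z => ‖M z‖ ^ 2), Measure.isProbabilityMeasure_map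
        hfinal.aemeasurable_limit⟩ := Subtype.ext (Measure.map_id.trans hlaw.symm)
  rw [hlim_eq]
  exact hfinal.tendsto
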